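/- For a positive integer $k$ and an integer $h$ let $$s(h,k)=\sum_{a=1}^{k}\left(\left(\frac ak\right)\right)\left(\left(\frac{ah}{k}\right)\right),$$ where $((x))=x-\lfloor x\rfloor-\tfrac12$ if $x\notin\mathbb{Z}$ and $((x))=0$ if $x\in\mathbb{Z}$, be the Dedekind sum. Let $m\ge 1$ be a fixed integer. Then there is exactly one arithmetic function $f_m:\{1,2,3,\dots\}\to\mathbb{R}$ whose Dirichlet series converges absolutely for $\operatorname{Re} s>1$ and satisfies there $$\sum_{k=1}^{\infty}\frac{f_m(k)}{k^{s}}=2\,\frac{\zeta(2m)^2\,\zeta(s+4m-1)}{\zeta(4m)\,\zeta(s+2m)^2}\,\zeta(s),$$ and for this $f_m$, as $k\to\infty$ through the positive integers (not necessarily primes), $$\sum_{\substack{1\le h\le k\\ (h,k)=1}} s(h,k)^{2m}=f_m(k)\left(\frac{k}{12}\right)^{2m}+O\!\left(\left(k^{9/5}+k^{2m-1+\frac1{m+1}}\right)\log^3 k\right),$$ where the implied constant, and how large $k$ has to be, may depend on $m$. -/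

import Mathlib

open scoped Asymptotics
noncomputable section

/-- The sawtooth function `((x))`: it is `x - ⌊x⌋ - 1/2` if `x` is not an integer and `0` if
`x` is an integer. -/
def sawtooth (x : ℝ) : ℝ :=
  open scoped Classical in
  if ∃ n : ℤ, (n : ℝ) = x then 0 else x - (⌊x⌋ : ℝ) - 1 / 2

/-- The Dedekind sum `s(h, k) = ∑_{a=1}^k ((a/k)) ((ah/k))`, for an integer `h` and a positive
integer `k`. -/
def dedekindSum (h : ℤ) (k : ℕ) : ℝ :=
  ∑ a ∈ Finset.Icc 1 k, sawtooth ((a : ℝ) / (k : ℝ)) * sawtooth ((a : ℝ) * (h : ℝ) / (k : ℝ))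

/-- The Dirichlet series of the arithmetic function `f` converges absolutely in the half-plane
`Re s > 1`, with sum `2 ζ(2m)² ζ(s + 4m - 1) ζ(s) / (ζ(4m) ζ(s + 2m)²)`. -/
def HasMomentFactorSeries (m : ℕ) (f : ArithmeticFunction ℝ) : Prop :=
  ∀ s : ℂ, 1 < s.re →
    LSeriesHasSum (fun k : ℕ => ((f k : ℝ) : ℂ)) s
      (2 * (riemannZeta (2 * (m : ℂ)) ^ 2 * riemannZeta (s + 4 * (m : ℂ) - 1)) /
          (riemannZeta (4 * (m : ℂ)) * riemannZeta (s + 2 * (m : ℂ)) ^ 2) *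
        riemannZeta s)

end

/-! A Dedekind sum `s(h, k)` is large only when `h / k` lies close to a fraction `a / q` with small
denominator. With `r = q h - a k`, the three-term relation gives `12 s(h, k) = k / (q r) + O(q |r|)`
(`abs_dedekindSum_sub_le`), and `q`, `r` satisfy `h q ≡ r` modulo `k`. So `(12 s(h, k)) ^ (2m)` is
compared with `k ^ (2m) / ζ(4m)` times the sum of `(q |r|) ^ (-2m)` over all such pairs
(`congruenceSum`). The factor `ζ(4m)` accounts for the multiples `(g q, g r)` of one primitive pair.

The comparison is made for each `h` separately (`abs_dedekindSum_pow_sub_le`). If some pair has `4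
(q |r|)² < k`, a primitive one gives the main term, and every pair not proportional to it has `q
|r|` at least of order `√k`. If there is no such pair, the Euclidean algorithm bounds `s(h, k)` by
`log k` times `k` over the least product `q |r|`. In both cases the error is a power of `k` and of
`log k` times `congruenceSum (3 / 2) h k`, and the sum of the latter over `h` is at most `2
ζ(3/2)²`.

The main term needs no estimate: counting solutions of `h q ≡ r` and inverting over `gcd(h, k)`
writes its sum over coprime `h` as a Dirichlet convolution (`coprimeCongruenceSum_eq`), whose
Dirichlet series is the stated product of zeta values. Uniqueness is that of Dirichlet coefficients.
-/

/-! ### Sawtooth function and elementary properties of Dedekind sums. -/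

theorem sawtooth_intCast (n : ℤ) : sawtooth n = 0 := by
  classical
  exact if_pos ⟨n, rfl⟩

theorem sawtooth_of_ne {x : ℝ} (hx : ∀ n : ℤ, (n : ℝ) ≠ x) : sawtooth x = x - ⌊x⌋ - 1 / 2 := by
  classical
  exact if_neg (by simpa using hx)

theorem sawtooth_add_intCast (x : ℝ) (n : ℤ) : sawtooth (x + n) = sawtooth x := by
  by_cases hx : ∃ l : ℤ, (l : ℝ) = x
  · obtain ⟨l, rfl⟩ := hx
    rw [← Int.cast_add, sawtooth_intCast, sawtooth_intCast]
  · push Not at hx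
    rw [sawtooth_of_ne hx, sawtooth_of_ne, Int.floor_add_intCast]
    · push_cast; ring
    · intro l hl
      exact hx (l - n) (by push_cast; linarith)

theorem sawtooth_neg (x : ℝ) : sawtooth (-x) = -sawtooth x := by
  by_cases hx : ∃ l : ℤ, (l : ℝ) = x
  · obtain ⟨l, rfl⟩ := hx
    rw [← Int.cast_neg, sawtooth_intCast, sawtooth_intCast, neg_zero]
  · push Not at hx
    have hx' : ∀ n : ℤ, (n : ℝ) ≠ -x := fun l hl => hx (-l) (by push_cast; linarith)
    rw [sawtooth_of_ne hx, sawtooth_of_ne hx']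
    have : ⌊-x⌋ = -⌊x⌋ - 1 := by
      rw [Int.floor_eq_iff]
      have h1 := Int.floor_le x
      have h2 := Int.lt_floor_add_one x
      have h3 := lt_of_le_of_ne h1 (hx _)
      push_cast
      constructor <;> linarith
    rw [this]; push_cast; ring

theorem abs_sawtooth_le (x : ℝ) : |sawtooth x| ≤ 1 / 2 := by
  by_cases hx : ∃ l : ℤ, (l : ℝ) = x
  · obtain ⟨l, rfl⟩ := hx
    rw [sawtooth_intCast]; norm_num
  · push Not at hx
    rw [sawtooth_of_ne hx, abs_le]
    have h1 := Int.floor_le x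
    have h2 := Int.lt_floor_add_one x
    constructor <;> linarith

theorem sawtooth_natCast_div {n k : ℕ} (hk : 0 < k) (h : ¬ k ∣ n) :
    sawtooth ((n : ℝ) / k) = ((n % k : ℕ) : ℝ) / k - 1 / 2 := by
  have hk' : (k : ℝ) ≠ 0 := by positivity
  have hfl : ⌊(n : ℝ) / k⌋ = ((n / k : ℕ) : ℤ) := by
    rw [← Nat.floor_div_eq_div (K := ℝ), Int.natCast_floor_eq_floor (by positivity)]
  rw [sawtooth_of_ne, hfl]
  · have := Nat.mod_add_div n k
    have h2 : (n : ℝ) = ((n % k : ℕ) : ℝ) + k * ((n / k : ℕ) : ℝ) := by exact_mod_cast this.symm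
    nth_rewrite 1 [h2]
    rw [Int.cast_natCast]
    field_simp
    ring
  · intro l hl
    rw [eq_div_iff hk'] at hl
    have : (l * k : ℤ) = n := by exact_mod_cast hl
    exact h (Int.natCast_dvd_natCast.mp ⟨l, by rw [← this, mul_comm]⟩)

theorem dedekindSum_add_mul (h n : ℤ) (k : ℕ) :
    dedekindSum (h + n * k) k = dedekindSum h k := by
  rcases Nat.eq_zero_or_pos k with rfl | hk
  · simp
  refine Finset.sum_congr rfl fun a _ => ?_
  have hk' : (k : ℝ) ≠ 0 := by positivity
  rw [show (a : ℝ) * ((h + n * k : ℤ) : ℝ) / k = a * h / k + ((a * n : ℤ) : ℝ) by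
    push_cast; field_simp, sawtooth_add_intCast]

theorem dedekindSum_neg (h : ℤ) (k : ℕ) : dedekindSum (-h) k = -dedekindSum h k := by
  unfold dedekindSum
  rw [← Finset.sum_neg_distrib]
  refine Finset.sum_congr rfl fun a _ => ?_
  rw [show (a : ℝ) * ((-h : ℤ) : ℝ) / k = -(a * h / k) by push_cast; ring, sawtooth_neg]
  ring

theorem abs_dedekindSum_le (h : ℤ) (k : ℕ) : |dedekindSum h k| ≤ k / 4 := by
  unfold dedekindSum
  refine (Finset.abs_sum_le_sum_abs _ _).trans ?_
  refine (Finset.sum_le_card_nsmul _ _ (1 / 4 : ℝ) fun a _ => ?_).trans ?_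
  · rw [abs_mul]
    have := mul_le_mul (abs_sawtooth_le ((a : ℝ) / k)) (abs_sawtooth_le ((a : ℝ) * h / k))
      (abs_nonneg _) (by norm_num)
    linarith
  · simp; linarith

theorem dedekindSum_one_right (h : ℤ) : dedekindSum h 1 = 0 := by
  simp only [dedekindSum, Finset.Icc_self, Finset.sum_singleton]
  have := sawtooth_intCast 1
  simp only [Int.cast_one] at this
  simp [this]

/-! ### The reciprocity law, by counting lattice points. -/

theorem sum_range_natCast (k : ℕ) : ∑ a ∈ Finset.range k, (a : ℝ) = k * (k - 1) / 2 := by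
  induction k with
  | zero => simp
  | succ n ih => rw [Finset.sum_range_succ, ih]; push_cast; ring

theorem sum_range_natCast_sq (k : ℕ) :
    ∑ a ∈ Finset.range k, (a : ℝ) ^ 2 = k * (k - 1) * (2 * k - 1) / 6 := by
  induction k with
  | zero => simp
  | succ n ih => rw [Finset.sum_range_succ, ih]; push_cast; ring

theorem sum_range_mul_mod {h k : ℕ} (hk : 0 < k) (hc : Nat.Coprime h k) (F : ℕ → ℝ) :
    ∑ a ∈ Finset.range k, F (a * h % k) = ∑ a ∈ Finset.range k, F a := by
  have hinj : Set.InjOn (fun a => a * h % k) (Finset.range k) := by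
    intro a ha b hb hab
    have : a ≡ b [MOD k] := Nat.ModEq.cancel_right_of_coprime hc.symm hab
    simp only [Finset.coe_range, Set.mem_Iio] at ha hb
    exact Nat.ModEq.eq_of_lt_of_lt this ha hb
  have himg : (Finset.range k).image (fun a => a * h % k) = Finset.range k := by
    apply Finset.eq_of_subset_of_card_le
    · intro x hx
      obtain ⟨a, -, rfl⟩ := Finset.mem_image.mp hx
      exact Finset.mem_range.mpr (Nat.mod_lt _ hk)
    · rw [Finset.card_image_of_injOn hinj]
  nth_rewrite 2 [← himg]
  rw [Finset.sum_image hinj]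

theorem sq_mul_dedekindSum {h k : ℕ} (hk : 0 < k) (hc : Nat.Coprime h k) :
    (k : ℝ) ^ 2 * dedekindSum h k =
      ∑ a ∈ Finset.range k, (a : ℝ) * ((a * h % k : ℕ) : ℝ) - (k : ℝ) ^ 2 * (k - 1) / 4 := by
  have hk' : (k : ℝ) ≠ 0 := by positivity
  have h1 : dedekindSum h k = ∑ a ∈ Finset.range k,
      sawtooth ((a : ℝ) / k) * sawtooth ((a : ℝ) * h / k) := by
    have h0 : sawtooth ((0 : ℕ) / k : ℝ) = 0 := by simpa using sawtooth_intCast 0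
    have hkk : sawtooth ((k : ℝ) / k) = 0 := by
      rw [div_self hk']; simpa using sawtooth_intCast 1
    have hs : ∀ g : ℕ → ℝ, g 0 = 0 → g k = 0 →
        ∑ a ∈ Finset.Icc 1 k, g a = ∑ a ∈ Finset.range k, g a := by
      intro g g0 gk
      have e : Finset.Icc 1 k = Finset.Ico 1 (k + 1) := by ext; simp
      have := Finset.sum_range_succ g k
      rw [Finset.range_eq_Ico, Finset.sum_eq_sum_Ico_succ_bot (by omega), g0, gk] at this
      rw [e]; simpa using this
    unfold dedekindSum
    rw [hs (fun a : ℕ => sawtooth ((a : ℝ) / k) * sawtooth ((a : ℝ) * ((h : ℤ) : ℝ) / k))]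
    · simp
    · rw [h0, zero_mul]
    · rw [hkk, zero_mul]
  -- At `a = 0` the product of linear forms is `k² / 4` but the sawtooth vanishes, hence the
  -- correction.
  have h2 : ∀ a ∈ Finset.range k, (k : ℝ) ^ 2 * (sawtooth ((a : ℝ) / k) * sawtooth ((a : ℝ) * h / k))
      = ((a : ℝ) - k / 2) * (((a * h % k : ℕ) : ℝ) - k / 2) - if a = 0 then (k : ℝ) ^ 2 / 4 else 0 := by
    intro a ha
    rw [Finset.mem_range] at ha
    rcases Nat.eq_zero_or_pos a with rfl | h0
    · have := sawtooth_intCast 0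
      simp only [Int.cast_zero] at this
      simp [this]; ring
    · have d1 : ¬ k ∣ a := Nat.not_dvd_of_pos_of_lt h0 ha
      have d2 : ¬ k ∣ a * h := fun hd => d1 (hc.symm.dvd_of_dvd_mul_right hd)
      rw [sawtooth_natCast_div hk d1, ← Nat.cast_mul, sawtooth_natCast_div hk d2,
        Nat.mod_eq_of_lt ha, if_neg (by omega)]
      field_simp
      ring
  rw [h1, Finset.mul_sum, Finset.sum_congr rfl h2, Finset.sum_sub_distrib, Finset.sum_ite_eq',
    if_pos (Finset.mem_range.mpr hk)]
  have h3 : ∑ a ∈ Finset.range k, ((a * h % k : ℕ) : ℝ) = k * (k - 1) / 2 := by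
    rw [sum_range_mul_mod hk hc (fun x => (x : ℝ)), sum_range_natCast]
  have h4 : ∀ a ∈ Finset.range k, ((a : ℝ) - k / 2) * (((a * h % k : ℕ) : ℝ) - k / 2) =
      a * ((a * h % k : ℕ) : ℝ) - k / 2 * a - k / 2 * ((a * h % k : ℕ) : ℝ) + k ^ 2 / 4 :=
    fun a _ => by ring
  rw [Finset.sum_congr rfl h4, Finset.sum_add_distrib, Finset.sum_sub_distrib,
    Finset.sum_sub_distrib, ← Finset.mul_sum, ← Finset.mul_sum, h3, sum_range_natCast]
  simp
  ring

theorem sum_range_div {h k : ℕ} (hk : 0 < k) (hc : Nat.Coprime h k) :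
    ∑ a ∈ Finset.range k, ((a * h / k : ℕ) : ℝ) = (h - 1) * (k - 1) / 2 := by
  have hk' : (k : ℝ) ≠ 0 := by positivity
  have h3 : ∑ a ∈ Finset.range k, ((a * h % k : ℕ) : ℝ) = k * (k - 1) / 2 := by
    rw [sum_range_mul_mod hk hc (fun x => (x : ℝ)), sum_range_natCast]
  have h4 : ∀ a ∈ Finset.range k, ((a * h % k : ℕ) : ℝ) = h * a - k * ((a * h / k : ℕ) : ℝ) := by
    intro a _
    have : ((a * h % k : ℕ) : ℝ) + k * ((a * h / k : ℕ) : ℝ) = a * h := by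
      exact_mod_cast Nat.mod_add_div (a * h) k
    linarith
  rw [Finset.sum_congr rfl h4, Finset.sum_sub_distrib, ← Finset.mul_sum, ← Finset.mul_sum,
    sum_range_natCast] at h3
  apply mul_left_cancel₀ hk'
  linarith

/-- Each square is a sum of consecutive odd numbers `2b - 1`. Exchanging the order of summation
counts the lattice points `b k ≤ a h` by rows instead of columns, which swaps the roles of `h` and
`k`. -/
theorem sum_range_div_sq {h k : ℕ} (hh : 0 < h) (hk : 0 < k) (hc : Nat.Coprime h k) :
    ∑ a ∈ Finset.range k, ((a * h / k : ℕ) : ℝ) ^ 2 =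
      (k - 1) * (h - 1) ^ 2 + (h - 1) * (k - 1) / 2 -
        2 * ∑ b ∈ Finset.range h, (b : ℝ) * ((b * k / h : ℕ) : ℝ) := by
  have hodd : ∀ n : ℕ, ∑ b ∈ Finset.Ico 1 (n + 1), (2 * (b : ℝ) - 1) = (n : ℝ) ^ 2 := by
    intro n
    induction n with
    | zero => simp
    | succ n ih => rw [Finset.sum_Ico_succ_top (by omega), ih]; push_cast; ring
  have h1 : ∀ a ∈ Finset.range k, ((a * h / k : ℕ) : ℝ) ^ 2 =
      ∑ b ∈ Finset.Ico 1 h, if b * k ≤ a * h then (2 * (b : ℝ) - 1) else 0 := by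
    intro a ha
    rw [Finset.mem_range] at ha
    rw [← hodd, ← Finset.sum_filter]
    congr 1
    ext b
    simp only [Finset.mem_Ico, Finset.mem_filter, Nat.lt_succ_iff, Nat.le_div_iff_mul_le hk]
    constructor
    · rintro ⟨h1, h2⟩
      refine ⟨⟨h1, ?_⟩, h2⟩
      by_contra hb
      push Not at hb
      nlinarith
    · rintro ⟨⟨h1, -⟩, h2⟩
      exact ⟨h1, h2⟩
  have h2 : ∀ b ∈ Finset.Ico 1 h,
      (∑ a ∈ Finset.range k, if b * k ≤ a * h then (2 * (b : ℝ) - 1) else 0) =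
      (2 * (b : ℝ) - 1) * (k - 1 - ((b * k / h : ℕ) : ℝ)) := by
    intro b hb
    rw [Finset.mem_Ico] at hb
    have hlt : b * k / h < k := by
      rw [Nat.div_lt_iff_lt_mul hh]; nlinarith
    have hd : ¬ h ∣ b * k := fun hd =>
      Nat.not_dvd_of_pos_of_lt hb.1 hb.2 (hc.dvd_of_dvd_mul_right hd)
    -- By coprimality no lattice point lies on the line `b k = a h`, so the inequality is strict.
    have hf : (Finset.range k).filter (fun a => b * k ≤ a * h) =
        Finset.Ico (b * k / h + 1) k := by
      ext a
      simp only [Finset.mem_filter, Finset.mem_range, Finset.mem_Ico, Nat.succ_le_iff,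
        Nat.div_lt_iff_lt_mul hh]
      constructor
      · rintro ⟨u, v⟩
        exact ⟨lt_of_le_of_ne v fun e => hd ⟨a, by rw [e, mul_comm]⟩, u⟩
      · rintro ⟨u, v⟩
        exact ⟨v, u.le⟩
    rw [← Finset.sum_filter, hf, Finset.sum_const, Nat.card_Ico, nsmul_eq_mul,
      Nat.cast_sub (by omega)]
    push_cast; ring
  rw [Finset.sum_congr rfl h1, Finset.sum_comm, Finset.sum_congr rfl h2]
  have h0 := sum_range_div hh hc.symm
  have h4 : ∀ g : ℕ → ℝ, ∑ b ∈ Finset.Ico 1 h, g b = ∑ b ∈ Finset.range h, g b - g 0 := by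
    intro g
    rw [Finset.range_eq_Ico, Finset.sum_eq_sum_Ico_succ_bot hh]; simp
  rw [h4]
  have h5 : ∀ b ∈ Finset.range h, (2 * (b : ℝ) - 1) * (k - 1 - ((b * k / h : ℕ) : ℝ)) =
      2 * (k - 1) * b - (k - 1) - 2 * (b * ((b * k / h : ℕ) : ℝ)) + ((b * k / h : ℕ) : ℝ) :=
    fun b _ => by ring
  rw [Finset.sum_congr rfl h5, Finset.sum_add_distrib, Finset.sum_sub_distrib,
    Finset.sum_sub_distrib, ← Finset.mul_sum, ← Finset.mul_sum, h0, sum_range_natCast]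
  simp
  ring

theorem sq_mul_dedekindSum_eq {h k : ℕ} (hk : 0 < k) (hc : Nat.Coprime h k) :
    (k : ℝ) ^ 2 * dedekindSum h k =
      h * (k * (k - 1) * (2 * k - 1) / 6) -
        k * ∑ a ∈ Finset.range k, (a : ℝ) * ((a * h / k : ℕ) : ℝ) - (k : ℝ) ^ 2 * (k - 1) / 4 := by
  rw [sq_mul_dedekindSum hk hc, ← sum_range_natCast_sq, Finset.mul_sum, Finset.mul_sum,
    ← Finset.sum_sub_distrib]
  congr 1
  refine Finset.sum_congr rfl fun a _ => ?_
  have : ((a * h % k : ℕ) : ℝ) + k * ((a * h / k : ℕ) : ℝ) = a * h := by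
    exact_mod_cast Nat.mod_add_div (a * h) k
  rw [show ((a * h % k : ℕ) : ℝ) = a * h - k * ((a * h / k : ℕ) : ℝ) by linarith]
  ring

/-- The residues of `a h` permute those of `a`, so their squares have the same sum. Expanding `a h -
k ⌊a h / k⌋` relates the mixed sum to the sum of squared quotients, and with `sum_range_div_sq` it
ties the mixed sums for `(h, k)` and `(k, h)` together. -/
theorem sum_range_sq_identity {h k : ℕ} (hk : 0 < k) (hc : Nat.Coprime h k) :
    (k : ℝ) * (k - 1) * (2 * k - 1) / 6 = h ^ 2 * (k * (k - 1) * (2 * k - 1) / 6) -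
      2 * h * k * ∑ a ∈ Finset.range k, (a : ℝ) * ((a * h / k : ℕ) : ℝ) +
      k ^ 2 * ∑ a ∈ Finset.range k, ((a * h / k : ℕ) : ℝ) ^ 2 := by
  rw [← sum_range_natCast_sq]
  nth_rewrite 1 [← sum_range_mul_mod hk hc (fun x => (x : ℝ) ^ 2)]
  rw [Finset.mul_sum, Finset.mul_sum, Finset.mul_sum, ← Finset.sum_sub_distrib,
    ← Finset.sum_add_distrib]
  refine Finset.sum_congr rfl fun a _ => ?_
  have : ((a * h % k : ℕ) : ℝ) + k * ((a * h / k : ℕ) : ℝ) = a * h := by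
    exact_mod_cast Nat.mod_add_div (a * h) k
  rw [show ((a * h % k : ℕ) : ℝ) = a * h - k * ((a * h / k : ℕ) : ℝ) by linarith]
  ring

/-- The reciprocity law for Dedekind sums. -/
theorem dedekindSum_reciprocity {h k : ℕ} (hh : 0 < h) (hk : 0 < k) (hc : Nat.Coprime h k) :
    12 * dedekindSum h k + 12 * dedekindSum k h =
      (h : ℝ) / k + k / h + 1 / (h * k) - 3 := by
  have e1 := sq_mul_dedekindSum_eq hk hc
  have e2 := sq_mul_dedekindSum_eq hh hc.symm
  have e3 := sum_range_sq_identity hk hc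
  rw [sum_range_div_sq hh hk hc] at e3
  have hk' : (k : ℝ) ≠ 0 := by positivity
  have hh' : (h : ℝ) ≠ 0 := by positivity
  set B := ∑ a ∈ Finset.range k, (a : ℝ) * ((a * h / k : ℕ) : ℝ)
  set B' := ∑ a ∈ Finset.range h, (a : ℝ) * ((a * k / h : ℕ) : ℝ)
  have e4 : dedekindSum h k = (h * (k * (k - 1) * (2 * k - 1) / 6) - k * B -
      (k : ℝ) ^ 2 * (k - 1) / 4) / k ^ 2 := by
    rw [eq_div_iff (by positivity), ← e1]; ring
  have e5 : dedekindSum k h = (k * (h * (h - 1) * (2 * h - 1) / 6) - h * B' -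
      (h : ℝ) ^ 2 * (h - 1) / 4) / h ^ 2 := by
    rw [eq_div_iff (by positivity), ← e2]; ring
  have e6 : B = (h ^ 2 * (k * (k - 1) * (2 * k - 1) / 6) - k * (k - 1) * (2 * k - 1) / 6 +
      k ^ 2 * ((k - 1) * (h - 1) ^ 2 + (h - 1) * (k - 1) / 2 - 2 * B')) / (2 * h * k) := by
    rw [eq_div_iff (by positivity)]; linarith
  rw [e4, e5, e6]
  field_simp
  ring

/-! ### Approximation of Dedekind sums near a rational point. -/

/-- A weak form of the three-term relation. The quantity inside the absolute value does not change
when `h / k` and `a / q` are both translated by an integer or both inverted, since these moves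
preserve the determinant `r`. Euclidean descent on `q` ends at `a = 0`, `q = 1`, `h = r`, where
reciprocity leaves `-12 s(k, r) - 3`, bounded trivially. -/
theorem abs_three_term_le_of_pos (q : ℕ) : ∀ (k : ℕ) (h a r : ℤ), 0 < q → 0 < k → 0 < r →
    IsCoprime h k → IsCoprime a q → q * h - a * k = r →
    |12 * dedekindSum h k - 12 * dedekindSum a q - ((k : ℝ) ^ 2 + q ^ 2 + r ^ 2) / (k * q * r)|
      ≤ 3 * (r : ℝ) + 3 := by
  induction q using Nat.strong_induction_on with
  | _ q ih =>
  intro k h a r hq hk hr hhk haq hdet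
  have hk' : (0 : ℝ) < k := by positivity
  have hq' : (0 : ℝ) < q := by positivity
  have hr' : (0 : ℝ) < r := by exact_mod_cast hr
  obtain ⟨a', t, ha0, haq', rfl⟩ : ∃ a' t : ℤ, 0 ≤ a' ∧ a' < q ∧ a = a' + t * q :=
    ⟨a % q, a / q, Int.emod_nonneg _ (by omega), Int.emod_lt_of_pos _ (by omega),
      by rw [mul_comm]; exact (Int.emod_add_mul_ediv a q).symm⟩
  obtain ⟨h', rfl⟩ : ∃ h' : ℤ, h = h' + t * k := ⟨h - t * k, by ring⟩
  rw [dedekindSum_add_mul, dedekindSum_add_mul]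
  have hhk' : IsCoprime h' k := (IsCoprime.add_mul_right_left_iff).mp hhk
  have haq1 : IsCoprime a' q := (IsCoprime.add_mul_right_left_iff).mp haq
  have hdet' : q * h' - a' * k = r := by linarith
  clear hdet hhk haq
  rcases ha0.eq_or_lt with rfl | ha0
  · have hq1 : q = 1 := by
      rw [isCoprime_zero_left] at haq1
      have := Int.isUnit_iff.mp haq1
      omega
    subst hq1
    obtain rfl : h' = r := by simpa using hdet'
    lift h' to ℕ using hr.le
    have hpos : 0 < h' := by exact_mod_cast hr
    have hrec := dedekindSum_reciprocity hpos hk (Nat.isCoprime_iff_coprime.mp hhk')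
    have bd := abs_le.mp (abs_dedekindSum_le k h')
    rw [dedekindSum_one_right]
    have : ((k : ℝ) ^ 2 + (1 : ℕ) ^ 2 + ((h' : ℤ) : ℝ) ^ 2) / (k * (1 : ℕ) * ((h' : ℤ) : ℝ)) =
        (h' : ℝ) / k + k / h' + 1 / (h' * k) := by
      have : (h' : ℝ) ≠ 0 := by positivity
      push_cast
      field_simp
      ring
    rw [this, abs_le]
    push_cast
    constructor <;> linarith [bd.1, bd.2]
  · have hh0 : 0 < h' := by
      have : 0 < (q : ℤ) * h' := by
        have : 0 < a' * k := by positivity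
        linarith
      exact pos_of_mul_pos_right this (by positivity)
    lift h' to ℕ using hh0.le
    lift a' to ℕ using ha0.le
    have hh1 : 0 < h' := by exact_mod_cast hh0
    have ha1 : 0 < a' := by exact_mod_cast ha0
    -- Inversion sends `h' / k` to `-k / h'` and `a' / q` to `-q / a'`; the constants `-3` of the
    -- two reciprocity laws cancel.
    have key := ih a' (by exact_mod_cast haq') h' (-k) (-q) r ha1 hh1 hr
      hhk'.symm.neg_left haq1.symm.neg_left (by rw [← hdet']; ring)
    rw [dedekindSum_neg, dedekindSum_neg] at key
    have r1 := dedekindSum_reciprocity hh1 hk (Nat.isCoprime_iff_coprime.mp hhk')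
    have r2 := dedekindSum_reciprocity ha1 hq (Nat.isCoprime_iff_coprime.mp haq1)
    have hR : (r : ℝ) = q * h' - a' * k := by rw [← hdet']; push_cast; ring
    have hid : (h' : ℝ) / k + k / h' + 1 / (h' * k) - (a' / q + q / a' + 1 / (a' * q)) =
        ((k : ℝ) ^ 2 + q ^ 2 + r ^ 2) / (k * q * r) -
          ((h' : ℝ) ^ 2 + a' ^ 2 + r ^ 2) / (h' * a' * r) := by
      have : (h' : ℝ) ≠ 0 := by positivity
      have : (a' : ℝ) ≠ 0 := by positivity
      field_simp
      rw [hR]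
      ring
    convert key using 2
    linarith

theorem abs_three_term_le {k q : ℕ} {h a r : ℤ} (hq : 0 < q) (hk : 0 < k) (hr : r ≠ 0)
    (hhk : IsCoprime h k) (haq : IsCoprime a q) (hdet : q * h - a * k = r) :
    |12 * dedekindSum h k - 12 * dedekindSum a q - ((k : ℝ) ^ 2 + q ^ 2 + r ^ 2) / (k * q * r)|
      ≤ 3 * |(r : ℝ)| + 3 := by
  rcases hr.lt_or_gt with hr | hr
  · have key := abs_three_term_le_of_pos q k (-h) (-a) (-r) hq hk (by omega) hhk.neg_left
      haq.neg_left (by rw [← hdet]; ring)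
    rw [dedekindSum_neg, dedekindSum_neg] at key
    have hr' : (r : ℝ) < 0 := by exact_mod_cast hr
    rw [abs_of_neg hr']
    rw [← abs_neg]
    convert key using 2
    · push_cast
      rw [neg_sq, mul_neg ((k : ℝ) * q), div_neg]
      ring
    · push_cast; ring
  · have hr' : (0 : ℝ) < r := by exact_mod_cast hr
    rw [abs_of_pos hr']
    exact abs_three_term_le_of_pos q k h a r hq hk hr hhk haq hdet

theorem one_le_abs_intCast {r : ℤ} (hr : r ≠ 0) : (1 : ℝ) ≤ |(r : ℝ)| := by
  exact_mod_cast Int.one_le_abs hr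

/-- A Dedekind sum at a fraction close to `a / q` is close to `k / (12 q r)`. -/
theorem abs_dedekindSum_sub_le {k q : ℕ} {h a r : ℤ} (hq : 0 < q) (hk : 0 < k) (hr : r ≠ 0)
    (hhk : IsCoprime h k) (haq : IsCoprime a q) (hdet : q * h - a * k = r) :
    |12 * dedekindSum h k - k / (q * r)| ≤ 11 * (q * |(r : ℝ)|) := by
  have key := abs_three_term_le hq hk hr hhk haq hdet
  have bd := abs_dedekindSum_le a q
  have hk' : (1 : ℝ) ≤ k := by exact_mod_cast hk
  have hq' : (1 : ℝ) ≤ q := by exact_mod_cast hq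
  have hr' := one_le_abs_intCast hr
  have hr0 : (r : ℝ) ≠ 0 := by exact_mod_cast hr
  have e : ((k : ℝ) ^ 2 + q ^ 2 + r ^ 2) / (k * q * r) = k / (q * r) + (q / (k * r) + r / (k * q)) := by
    field_simp
    ring
  have b1 : |(q : ℝ) / (k * r)| ≤ q := by
    rw [abs_div, abs_mul, abs_of_pos (by linarith : (0 : ℝ) < q), abs_of_pos (by linarith : (0 : ℝ) < k)]
    exact div_le_self (by linarith) (by nlinarith)
  have b2 : |(r : ℝ) / (k * q)| ≤ |(r : ℝ)| := by
    rw [abs_div, abs_mul, abs_of_pos (by linarith : (0 : ℝ) < q), abs_of_pos (by linarith : (0 : ℝ) < k)]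
    exact div_le_self (by linarith) (by nlinarith)
  rw [e] at key
  -- The total error is at most `4 (q + |r|) + 3 ≤ 4 (q |r| + 1) + 3 ≤ 11 q |r|`.
  have m1 : (q : ℝ) + |(r : ℝ)| ≤ q * |(r : ℝ)| + 1 := by nlinarith
  have m2 : 1 ≤ q * |(r : ℝ)| := by nlinarith
  rw [abs_le] at key bd b1 b2 ⊢
  constructor <;> linarith [key.1, key.2, bd.1, bd.2, b1.1, b1.2, b2.1, b2.2]

/-! ### A logarithmic bound from the Euclidean algorithm. -/

/-- Here `x`, `y` are consecutive remainders of the Euclidean algorithm for `h / k`, `Q`, `P` the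
matching continuants, and `ε` the alternating sign. Each reciprocity step costs about `y / x`, and
`(Q, ε x)` is a pair to which `hM` applies, so no partial quotient exceeds `M`. -/
theorem abs_dedekindSum_le_euclid {h : ℤ} {k : ℕ} {M : ℝ}
    (hM : ∀ (q : ℕ) (r : ℤ), q ≠ 0 → r ≠ 0 → (k : ℤ) ∣ h * q - r → (k : ℝ) ≤ M * (q * |(r : ℝ)|))
    (x : ℕ) : ∀ (y P Q : ℕ) (ε : ℤ), |ε| = 1 → 0 < x → x ≤ y → Nat.Coprime x y → 0 < Q →
      y * Q + x * P = k → (k : ℤ) ∣ h * Q - ε * x → (k : ℤ) ∣ h * P + ε * y →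
      |12 * dedekindSum x y| ≤ (M + 5) * (Nat.log 2 (x * y) + 1) := by
  induction x using Nat.strong_induction_on with
  | _ x ih =>
  intro y P Q ε hε hx hxy hc hQ hsum hv1 hv2
  have hy : 0 < y := by omega
  have hx' : (1 : ℝ) ≤ x := by exact_mod_cast hx
  have hxy' : (x : ℝ) ≤ y := by exact_mod_cast hxy
  have hQ' : (1 : ℝ) ≤ Q := by exact_mod_cast hQ
  have hε0 : ε ≠ 0 := by rintro rfl; simp at hε
  have hεR : |(ε : ℝ)| = 1 := by exact_mod_cast hε
  -- From `y Q ≤ k ≤ M Q x`.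
  have b1 : (y : ℝ) / x ≤ M := by
    have h1 := hM Q (ε * x) (by omega) (mul_ne_zero hε0 (by omega)) hv1
    have h2 : (y : ℝ) * Q ≤ k := by
      rw [← hsum]; push_cast; have : (0 : ℝ) ≤ x * P := by positivity
      linarith
    push_cast at h1
    rw [abs_mul, hεR, one_mul, Nat.abs_cast] at h1
    rw [div_le_iff₀ (by linarith)]
    have : (Q : ℝ) * y ≤ Q * (M * x) := by nlinarith
    exact le_of_mul_le_mul_left this (by linarith)
  have hM0 : 1 ≤ M := le_trans (by rw [le_div_iff₀ (by linarith)]; linarith) b1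
  have b0 : 0 ≤ (y : ℝ) / x := by positivity
  have b2 : (x : ℝ) / y ≤ 1 := by rw [div_le_one (by linarith)]; exact hxy'
  have b2' : 0 ≤ (x : ℝ) / y := by positivity
  have b3 : 1 / ((x : ℝ) * y) ≤ 1 := by rw [div_le_one (by positivity)]; nlinarith
  have b3' : 0 ≤ 1 / ((x : ℝ) * y) := by positivity
  have hrec := dedekindSum_reciprocity hx hy hc
  have hmod : dedekindSum y x = dedekindSum (y % x : ℕ) x := by
    have := dedekindSum_add_mul (y % x : ℕ) (y / x : ℕ) x
    rw [← this]
    congr 1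
    have := Nat.mod_add_div' y x
    exact_mod_cast this.symm
  have hstep : |12 * dedekindSum x y| ≤ M + 5 + |12 * dedekindSum (y % x : ℕ) x| := by
    rw [← hmod, show 12 * dedekindSum x y = (x / y + y / x + 1 / (x * y) - 3) - 12 * dedekindSum y x
      by linarith]
    refine (abs_sub _ _).trans (add_le_add_left ?_ _)
    rw [abs_le]; constructor <;> linarith
  rcases Nat.eq_zero_or_pos (y % x) with h0 | h0
  · have hx1 : x = 1 := by
      have := Nat.gcd_rec x y
      rw [h0, Nat.gcd_zero_left] at this
      rw [← this]; exact hc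
    subst hx1
    rw [dedekindSum_one_right, mul_zero, abs_zero, add_zero] at hstep
    refine hstep.trans ?_
    have : (0 : ℝ) ≤ Nat.log 2 (1 * y) := by positivity
    nlinarith
  · have hlt := Nat.mod_lt y hx
    have hc' : Nat.Coprime (y % x) x := by
      have := Nat.gcd_rec x y
      unfold Nat.Coprime
      rw [← this]; exact hc
    have hyd := Nat.mod_add_div' y x
    have IH := ih (y % x) hlt x Q (P + y / x * Q) (-ε) (by rwa [abs_neg]) h0 hlt.le hc'
      (by
        have : 0 < y / x := Nat.div_pos hxy hx
        positivity)
      (by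
        rw [← hsum]
        nth_rewrite 3 [← hyd]
        ring)
      (by
        have : h * ((P + y / x * Q : ℕ) : ℤ) - -ε * ((y % x : ℕ) : ℤ) =
            (h * P + ε * y) + ((y / x : ℕ) : ℤ) * (h * Q - ε * x) := by
          have e : (y : ℤ) = ((y % x : ℕ) : ℤ) + ((y / x : ℕ) : ℤ) * x := by
            exact_mod_cast hyd.symm
          rw [show (h * P + ε * y : ℤ) = h * P + ε * (((y % x : ℕ) : ℤ) + ((y / x : ℕ) : ℤ) * x) by
            rw [← e]]
          push_cast
          ring
        rw [this]
        exact dvd_add hv2 (dvd_mul_of_dvd_right hv1 _))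
      (by rw [show h * (Q : ℤ) + -ε * x = h * Q - ε * x by ring]; exact hv1)
    -- The product of consecutive remainders at least halves at each step, because `2 (y % x) ≤ y`.
    have hlog : Nat.log 2 (y % x * x) + 1 ≤ Nat.log 2 (x * y) := by
      rw [← Nat.log_mul_base (by norm_num) (by positivity)]
      apply Nat.log_mono_right
      have : 2 * (y % x) ≤ y := by
        have : 1 * x ≤ y / x * x := Nat.mul_le_mul_right _ (Nat.div_pos hxy hx)
        omega
      nlinarith
    have hlog' : ((Nat.log 2 (y % x * x) : ℝ)) + 1 ≤ Nat.log 2 (x * y) := by exact_mod_cast hlog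
    nlinarith

theorem abs_dedekindSum_le_log {h k : ℕ} (hh : 0 < h) (hhk : h ≤ k) (hc : Nat.Coprime h k)
    (hk : 3 ≤ k) {M : ℝ}
    (hM : ∀ (q : ℕ) (r : ℤ), q ≠ 0 → r ≠ 0 → (k : ℤ) ∣ h * q - r → (k : ℝ) ≤ M * (q * |(r : ℝ)|)) :
    |12 * dedekindSum h k| ≤ 30 * M * Real.log k := by
  have hM1 : 1 ≤ M := by
    have h1 := hM 1 h (by omega) (by omega) (by simp)
    have h2 : (h : ℝ) ≤ k := by exact_mod_cast hhk
    have h3 : (1 : ℝ) ≤ h := by exact_mod_cast hh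
    simp at h1
    nlinarith
  -- Initial state of the algorithm: `P = 0`, `Q = 1`, `ε = 1`.
  have key := abs_dedekindSum_le_euclid (h := h) hM h k 0 1 1 (by simp) hh hhk hc
    one_pos (by ring) (by simp) (by simp)
  have hk0 : (0 : ℝ) < k := by exact_mod_cast (by omega : 0 < k)
  have hlog1 : 1 ≤ Real.log k := by
    rw [Real.le_log_iff_exp_le hk0]
    have := Real.exp_one_lt_d9
    have : (3 : ℝ) ≤ k := by exact_mod_cast hk
    linarith
  have hlog : (Nat.log 2 (h * k) : ℝ) ≤ 4 * Real.log k := by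
    have h1 : (2 : ℝ) ^ Nat.log 2 (h * k) ≤ k ^ 2 := by
      have := Nat.pow_log_le_self 2 (show h * k ≠ 0 by positivity)
      have h2 : h * k ≤ k ^ 2 := by nlinarith
      exact_mod_cast this.trans h2
    have h3 := Real.log_le_log (by positivity) h1
    rw [Real.log_pow, Real.log_pow] at h3
    have := Real.log_two_gt_d9
    push_cast at h3
    have : (0 : ℝ) ≤ Nat.log 2 (h * k) := by positivity
    nlinarith
  refine key.trans ?_
  have : (M + 5) * (Nat.log 2 (h * k) + 1) ≤ (6 * M) * (5 * Real.log k) := by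
    apply mul_le_mul <;> first | positivity | linarith
  linarith

/-! ### Power functions and their Dirichlet inverses. -/

/-- The arithmetic function `n ↦ n ^ e` with a real exponent. -/
noncomputable def rpowArith (e : ℝ) : ArithmeticFunction ℝ :=
  ⟨fun n => if n = 0 then 0 else (n : ℝ) ^ e, if_pos rfl⟩

theorem rpowArith_apply {e : ℝ} {n : ℕ} (hn : n ≠ 0) : rpowArith e n = (n : ℝ) ^ e := if_neg hn

theorem mul_pmul_rpowArith (f g : ArithmeticFunction ℝ) (e : ℝ) :
    (f * g).pmul (rpowArith e) = f.pmul (rpowArith e) * g.pmul (rpowArith e) := by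
  ext n
  rw [ArithmeticFunction.pmul_apply, ArithmeticFunction.mul_apply, ArithmeticFunction.mul_apply,
    Finset.sum_mul]
  refine Finset.sum_congr rfl fun x hx => ?_
  obtain ⟨rfl, hn⟩ := Nat.mem_divisorsAntidiagonal.mp hx
  rw [ArithmeticFunction.pmul_apply, ArithmeticFunction.pmul_apply, rpowArith_apply hn,
    rpowArith_apply (left_ne_zero_of_mul hn), rpowArith_apply (right_ne_zero_of_mul hn),
    Nat.cast_mul, Real.mul_rpow (by positivity) (by positivity)]
  ring

/-- The arithmetic function `n ↦ μ(n) n ^ e`. -/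
noncomputable def moebiusRpow (e : ℝ) : ArithmeticFunction ℝ :=
  (ArithmeticFunction.moebius : ArithmeticFunction ℝ).pmul (rpowArith e)

theorem moebiusRpow_mul_rpowArith (e : ℝ) : moebiusRpow e * rpowArith e = 1 := by
  have h1 : rpowArith e = (ArithmeticFunction.zeta : ArithmeticFunction ℝ).pmul (rpowArith e) := by
    rw [ArithmeticFunction.zeta_pmul]
  rw [moebiusRpow]
  nth_rewrite 2 [h1]
  rw [← mul_pmul_rpowArith, ArithmeticFunction.coe_moebius_mul_coe_zeta]
  ext n
  rw [ArithmeticFunction.pmul_apply, ArithmeticFunction.one_apply]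
  split_ifs with h
  · subst h
    rw [rpowArith_apply one_ne_zero]; simp
  · simp

/-- The convolution `μ * n ^ (1 - σ)`, twisted by `n ^ (-σ)`. -/
theorem moebius_mul_rpowArith_pmul (σ : ℝ) :
    ((ArithmeticFunction.moebius : ArithmeticFunction ℝ) * rpowArith (1 - σ)).pmul (rpowArith (-σ))
      = moebiusRpow (-σ) * rpowArith (1 - 2 * σ) := by
  rw [mul_pmul_rpowArith, moebiusRpow]
  congr 1
  ext n
  rw [ArithmeticFunction.pmul_apply]
  rcases eq_or_ne n 0 with rfl | hn
  · simp
  · rw [rpowArith_apply hn, rpowArith_apply hn, rpowArith_apply hn,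
      ← Real.rpow_add (by positivity)]
    congr 1; ring

/-! ### Sums over solutions of `h q ≡ r` modulo `k`, and their exact averages. -/

/-- The sum `∑ n ^ (-σ)` over the natural numbers, that is `ζ(σ)` for real `σ > 1`. -/
noncomputable def zetaSum (σ : ℝ) : ℝ := ∑' n : ℕ, (n : ℝ) ^ (-σ)

theorem summable_natCast_rpow {σ : ℝ} (hσ : 1 < σ) : Summable fun n : ℕ => (n : ℝ) ^ (-σ) :=
  Real.summable_nat_rpow.mpr (by linarith)

theorem zetaSum_nonneg (σ : ℝ) : 0 ≤ zetaSum σ := tsum_nonneg fun n => by positivity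

theorem tsum_abs_intCast_rpow {σ : ℝ} (hσ : 1 < σ) :
    ∑' r : ℤ, |(r : ℝ)| ^ (-σ) = 2 * zetaSum σ := by
  have hs := summable_natCast_rpow hσ
  have hs1 : Summable fun n : ℕ => ((n + 1 : ℕ) : ℝ) ^ (-σ) := (summable_nat_add_iff 1).mpr hs
  have e : ∀ n : ℕ, |((-((n : ℤ) + 1) : ℤ) : ℝ)| ^ (-σ) = ((n + 1 : ℕ) : ℝ) ^ (-σ) := by
    intro n
    rw [Int.cast_neg, abs_neg]
    push_cast
    rw [abs_of_nonneg (by positivity)]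
  rw [tsum_of_nat_of_neg_add_one]
  · simp_rw [e]
    have h2 : zetaSum σ = ∑' n : ℕ, ((n + 1 : ℕ) : ℝ) ^ (-σ) := by
      rw [zetaSum, hs.tsum_eq_zero_add, Nat.cast_zero, Real.zero_rpow (by linarith), zero_add]
    simp only [Int.cast_natCast, Nat.abs_cast]
    rw [← h2, zetaSum]; ring
  · simpa using hs
  · simpa only [e] using hs1

/-- The sum of `(q |r|) ^ (-σ)` over the pairs of a natural number `q` and an integer `r`, both
nonzero, with `h q ≡ r` modulo `k`. -/
noncomputable def congruenceSum (σ : ℝ) (h : ℤ) (k : ℕ) : ℝ :=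
  ∑' p : ℕ × ℤ, if (k : ℤ) ∣ h * p.1 - p.2 then ((p.1 : ℝ) * |(p.2 : ℝ)|) ^ (-σ) else 0

theorem summable_pair {σ : ℝ} (hσ : 1 < σ) :
    Summable fun p : ℕ × ℤ => ((p.1 : ℝ) * |(p.2 : ℝ)|) ^ (-σ) := by
  have := (summable_natCast_rpow hσ).mul_of_nonneg (Real.summable_abs_int_rpow hσ)
    (fun n => by positivity) (fun n => by positivity)
  refine this.congr fun p => ?_
  rw [Real.mul_rpow (by positivity) (by positivity)]

theorem summable_pair_ite {σ : ℝ} (hσ : 1 < σ) (P : ℕ × ℤ → Prop) [DecidablePred P] :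
    Summable fun p : ℕ × ℤ => if P p then ((p.1 : ℝ) * |(p.2 : ℝ)|) ^ (-σ) else 0 := by
  refine (summable_pair hσ).of_nonneg_of_le (fun p => ?_) (fun p => ?_)
  · split_ifs <;> positivity
  · split_ifs
    · exact le_rfl
    · positivity

theorem congruenceSum_nonneg (σ : ℝ) (h : ℤ) (k : ℕ) : 0 ≤ congruenceSum σ h k :=
  tsum_nonneg fun p => by split_ifs <;> positivity

theorem tsum_dvd_int {σ : ℝ} (hσ : 1 < σ) {g : ℕ} (hg : g ≠ 0) :
    ∑' r : ℤ, (if (g : ℤ) ∣ r then |(r : ℝ)| ^ (-σ) else 0) = (g : ℝ) ^ (-σ) * (2 * zetaSum σ) := by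
  rw [← tsum_abs_intCast_rpow hσ, ← tsum_mul_left]
  have hinj : Function.Injective fun r : ℤ => (g : ℤ) * r :=
    mul_right_injective₀ (by exact_mod_cast hg)
  rw [← hinj.tsum_eq]
  · refine tsum_congr fun r => ?_
    rw [if_pos (dvd_mul_right _ _)]
    push_cast
    rw [abs_mul, Nat.abs_cast, Real.mul_rpow (by positivity) (by positivity)]
  · intro r hr
    rw [Function.mem_support] at hr
    by_cases hd : (g : ℤ) ∣ r
    · obtain ⟨s, rfl⟩ := hd
      exact ⟨s, rfl⟩
    · rw [if_neg hd] at hr; exact absurd rfl hr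

theorem tsum_dvd_nat {σ : ℝ} {d : ℕ} (hd : d ≠ 0) :
    ∑' q : ℕ, (if d ∣ q then (q : ℝ) ^ (-σ) else 0) = (d : ℝ) ^ (-σ) * zetaSum σ := by
  rw [zetaSum, ← tsum_mul_left]
  have hinj : Function.Injective fun r : ℕ => d * r := mul_right_injective₀ hd
  rw [← hinj.tsum_eq]
  · refine tsum_congr fun r => ?_
    rw [if_pos (dvd_mul_right _ _)]
    push_cast
    rw [Real.mul_rpow (by positivity) (by positivity)]
  · intro r hr
    rw [Function.mem_support] at hr
    by_cases hd : d ∣ r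
    · obtain ⟨s, rfl⟩ := hd
      exact ⟨s, rfl⟩
    · rw [if_neg hd] at hr; exact absurd rfl hr

/-- With `g = gcd(q, k)` dividing `r`, the congruence becomes one modulo `k / g` with invertible
coefficient. It fixes one class modulo `k / g`, which meets an interval of length `k` in `g` points.
-/
theorem card_filter_dvd {k : ℕ} (hk : 0 < k) (q : ℕ) (r : ℤ) :
    ((Finset.Icc 1 k).filter fun h : ℕ => (k : ℤ) ∣ h * q - r).card =
      if ((Nat.gcd q k : ℕ) : ℤ) ∣ r then Nat.gcd q k else 0 := by
  have hg : 0 < Nat.gcd q k := Nat.gcd_pos_of_pos_right _ hk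
  split_ifs with hd
  · obtain ⟨r', rfl⟩ := hd
    obtain ⟨q', k', hco, hq, hk1⟩ := Nat.exists_coprime q k
    set g := Nat.gcd q k
    clear_value g
    subst hq hk1
    have hk' : 0 < k' := Nat.pos_of_mul_pos_right hk
    obtain ⟨u, v, huv⟩ := Nat.isCoprime_iff_coprime.mpr hco
    obtain ⟨c, hc⟩ : ∃ c : ℕ, (c : ℤ) = (u * r') % k' :=
      ⟨((u * r') % k').toNat, Int.toNat_of_nonneg (Int.emod_nonneg _ (by omega))⟩
    have hcm : (k' : ℤ) ∣ u * r' - c := by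
      rw [hc]; exact Int.dvd_self_sub_emod
    have e : (Finset.Icc 1 (k' * g)).filter
        (fun h : ℕ => ((k' * g : ℕ) : ℤ) ∣ h * ((q' * g : ℕ) : ℤ) - g * r') =
        (Finset.Ioc 0 (k' * g)).filter (fun h : ℕ => h ≡ c [MOD k']) := by
      ext h
      simp only [Finset.mem_filter, Finset.mem_Icc, Finset.mem_Ioc]
      refine and_congr (by omega) ?_
      rw [← Int.natCast_modEq_iff, Int.modEq_comm, Int.modEq_iff_dvd]
      push_cast
      rw [show (h : ℤ) * (q' * g) - g * r' = (h * q' - r') * g by ring,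
        mul_dvd_mul_iff_right (by omega : (g : ℤ) ≠ 0)]
      constructor
      · intro hh
        have : (h : ℤ) - c = u * (h * q' - r') + (u * r' - c) + h * v * k' := by
          linear_combination (-(h : ℤ)) * huv
        rw [this]
        exact dvd_add (dvd_add (dvd_mul_of_dvd_right hh _) hcm) (dvd_mul_left _ _)
      · intro hh
        have : (h : ℤ) * q' - r' = q' * (h - c) - q' * (u * r' - c) - r' * v * k' := by
          linear_combination (r' : ℤ) * huv
        rw [this]
        exact dvd_sub (dvd_sub (dvd_mul_of_dvd_right hh _) (dvd_mul_of_dvd_right hcm _))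
          (dvd_mul_left _ _)
    rw [e]
    have key := Nat.Ioc_filter_modEq_card 0 (k' * g) hk' c
    have hk0 : (k' : ℚ) ≠ 0 := by positivity
    have e2 : ((k' * g : ℕ) - (c : ℚ)) / k' = ((0 : ℕ) - (c : ℚ)) / k' + (g : ℤ) := by
      push_cast; field_simp; ring
    rw [e2, Int.floor_add_intCast] at key
    have : (max (⌊((0 : ℕ) - (c : ℚ)) / k'⌋ + (g : ℤ) - ⌊((0 : ℕ) - (c : ℚ)) / k'⌋) 0) = (g : ℤ) := by
      rw [add_sub_cancel_left]; exact max_eq_left (by positivity)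
    rw [this] at key
    exact_mod_cast key
  · rw [Finset.card_eq_zero, Finset.filter_eq_empty_iff]
    intro h _ hh
    apply hd
    have h1 : ((Nat.gcd q k : ℕ) : ℤ) ∣ h * q - r :=
      (Int.natCast_dvd_natCast.mpr (Nat.gcd_dvd_right q k)).trans hh
    have h2 : ((Nat.gcd q k : ℕ) : ℤ) ∣ h * q :=
      dvd_mul_of_dvd_right (Int.natCast_dvd_natCast.mpr (Nat.gcd_dvd_left q k)) _
    exact (dvd_sub_right h2).mp h1

theorem summable_gcd_rpow {σ : ℝ} (hσ : 1 < σ) {k : ℕ} (hk : 0 < k) :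
    Summable fun q : ℕ => (Nat.gcd q k : ℝ) ^ (1 - σ) * (q : ℝ) ^ (-σ) := by
  refine (summable_natCast_rpow hσ).of_nonneg_of_le (fun p => by positivity) (fun q => ?_)
  have hg : (1 : ℝ) ≤ Nat.gcd q k := by exact_mod_cast Nat.gcd_pos_of_pos_right _ hk
  exact mul_le_of_le_one_left (by positivity) (Real.rpow_le_one_of_one_le_of_nonpos hg (by linarith))

theorem sum_congruenceSum {σ : ℝ} (hσ : 1 < σ) {k : ℕ} (hk : 0 < k) :
    ∑ h ∈ Finset.Icc 1 k, congruenceSum σ h k =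
      2 * zetaSum σ * ∑' q : ℕ, (Nat.gcd q k : ℝ) ^ (1 - σ) * (q : ℝ) ^ (-σ) := by
  unfold congruenceSum
  rw [← Summable.tsum_finsetSum fun h _ => summable_pair_ite hσ _]
  have e : ∀ p : ℕ × ℤ, (∑ h ∈ Finset.Icc 1 k, if (k : ℤ) ∣ ((h : ℕ) : ℤ) * p.1 - p.2 then
      ((p.1 : ℝ) * |(p.2 : ℝ)|) ^ (-σ) else 0) =
      (p.1 : ℝ) ^ (-σ) * (Nat.gcd p.1 k *
        if ((Nat.gcd p.1 k : ℕ) : ℤ) ∣ p.2 then |(p.2 : ℝ)| ^ (-σ) else 0) := by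
    intro p
    rw [← Finset.sum_filter, Finset.sum_const, card_filter_dvd hk, nsmul_eq_mul,
      Real.mul_rpow (by positivity) (by positivity)]
    split_ifs
    · ring
    · simp
  have hs : Summable fun p : ℕ × ℤ => (p.1 : ℝ) ^ (-σ) * (Nat.gcd p.1 k *
        if ((Nat.gcd p.1 k : ℕ) : ℤ) ∣ p.2 then |(p.2 : ℝ)| ^ (-σ) else 0) := by
    exact (summable_congr e).mp (summable_sum fun h _ => summable_pair_ite hσ _)
  rw [tsum_congr e, hs.tsum_prod, ← tsum_mul_left]
  refine tsum_congr fun q => ?_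
  have hg : 0 < Nat.gcd q k := Nat.gcd_pos_of_pos_right _ hk
  simp only
  rw [tsum_mul_left, tsum_mul_left, tsum_dvd_int hσ hg.ne', sub_eq_add_neg, Real.rpow_add
    (by positivity), Real.rpow_one]
  ring

theorem sum_congruenceSum_le {σ : ℝ} (hσ : 1 < σ) {k : ℕ} (hk : 0 < k) :
    ∑ h ∈ Finset.Icc 1 k, congruenceSum σ h k ≤ 2 * zetaSum σ ^ 2 := by
  rw [sum_congruenceSum hσ hk, sq, ← mul_assoc]
  refine mul_le_mul_of_nonneg_left ?_ (mul_nonneg zero_le_two (zetaSum_nonneg σ))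
  refine (summable_gcd_rpow hσ hk).tsum_le_tsum (fun q => ?_) (summable_natCast_rpow hσ)
  have hg : (1 : ℝ) ≤ Nat.gcd q k := by exact_mod_cast Nat.gcd_pos_of_pos_right _ hk
  exact mul_le_of_le_one_left (by positivity) (Real.rpow_le_one_of_one_le_of_nonpos hg (by linarith))

/-- Write `n ^ (1 - σ)` as the divisor sum of its Möbius transform `J`. The divisors of `gcd(q, k)`
are the divisors of `k` that divide `q`, so the sum over `q` contributes `d ^ (-σ) ζ(σ)` for each `d
∣ k`. -/
theorem tsum_gcd_rpow {σ : ℝ} (hσ : 1 < σ) {k : ℕ} (hk : 0 < k) :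
    ∑' q : ℕ, (Nat.gcd q k : ℝ) ^ (1 - σ) * (q : ℝ) ^ (-σ) =
      zetaSum σ * ((ArithmeticFunction.zeta : ArithmeticFunction ℝ) *
        (moebiusRpow (-σ) * rpowArith (1 - 2 * σ))) k := by
  rw [← moebius_mul_rpowArith_pmul, ArithmeticFunction.coe_zeta_mul_apply, Finset.mul_sum]
  set J := (ArithmeticFunction.moebius : ArithmeticFunction ℝ) * rpowArith (1 - σ) with hJ
  have hgcd : ∀ n : ℕ, n ≠ 0 → (n : ℝ) ^ (1 - σ) = ∑ d ∈ n.divisors, J d := by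
    intro n hn
    rw [← ArithmeticFunction.coe_zeta_mul_apply, hJ, ← mul_assoc,
      ArithmeticFunction.coe_zeta_mul_coe_moebius, one_mul, rpowArith_apply hn]
  have e : ∀ q : ℕ, (Nat.gcd q k : ℝ) ^ (1 - σ) * (q : ℝ) ^ (-σ) =
      ∑ d ∈ k.divisors, J d * if d ∣ q then (q : ℝ) ^ (-σ) else 0 := by
    intro q
    have hg : 0 < Nat.gcd q k := Nat.gcd_pos_of_pos_right _ hk
    rw [hgcd _ hg.ne', Finset.sum_mul]
    have hsub : (Nat.gcd q k).divisors = k.divisors.filter (fun d => d ∣ q) := by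
      ext d
      simp only [Nat.mem_divisors, Finset.mem_filter, Nat.dvd_gcd_iff]
      constructor
      · rintro ⟨⟨h1, h2⟩, -⟩; exact ⟨⟨h2, hk.ne'⟩, h1⟩
      · rintro ⟨⟨h1, -⟩, h2⟩; exact ⟨⟨h2, h1⟩, hg.ne'⟩
    rw [hsub, Finset.sum_filter]
    refine Finset.sum_congr rfl fun d _ => ?_
    split_ifs <;> simp
  have hs : ∀ d : ℕ, Summable fun q : ℕ => J d * if d ∣ q then (q : ℝ) ^ (-σ) else 0 := by
    intro d
    refine Summable.mul_left _ ((summable_natCast_rpow hσ).of_nonneg_of_le (fun p => ?_) (fun p => ?_))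
    · split_ifs <;> positivity
    · split_ifs
      · exact le_rfl
      · positivity
  rw [tsum_congr e, Summable.tsum_finsetSum fun d _ => hs d]
  refine Finset.sum_congr rfl fun d hd => ?_
  have hd0 : d ≠ 0 := (Nat.pos_of_mem_divisors hd).ne'
  rw [tsum_mul_left, tsum_dvd_nat hd0, ArithmeticFunction.pmul_apply, rpowArith_apply hd0]
  ring

/-- The congruence `d h q ≡ r` modulo `d k` forces `d ∣ r`; dividing `r` by `d` gives the scaling.
-/
theorem congruenceSum_mul_left {σ : ℝ} {d : ℕ} (hd : d ≠ 0) (h : ℤ) (k : ℕ) :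
    congruenceSum σ (d * h) (d * k) = (d : ℝ) ^ (-σ) * congruenceSum σ h k := by
  have hd' : (d : ℤ) ≠ 0 := by exact_mod_cast hd
  unfold congruenceSum
  rw [← tsum_mul_left]
  have hinj : Function.Injective fun p : ℕ × ℤ => (p.1, (d : ℤ) * p.2) := by
    rintro ⟨a, b⟩ ⟨a', b'⟩ hab
    simp only [Prod.mk.injEq, mul_eq_mul_left_iff] at hab ⊢
    exact ⟨hab.1, hab.2.resolve_right hd'⟩
  rw [← hinj.tsum_eq]
  · refine tsum_congr fun p => ?_
    push_cast
    have : (d : ℤ) * k ∣ d * h * p.1 - d * p.2 ↔ (k : ℤ) ∣ h * p.1 - p.2 := by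
      rw [show (d : ℤ) * h * p.1 - d * p.2 = d * (h * p.1 - p.2) by ring,
        mul_dvd_mul_iff_left hd']
    simp only [this]
    split_ifs
    · rw [abs_mul, Nat.abs_cast, mul_left_comm, Real.mul_rpow (by positivity) (by positivity)]
    · simp
  · intro p hp
    rw [Function.mem_support] at hp
    by_cases hk : ((d * k : ℕ) : ℤ) ∣ d * h * p.1 - p.2
    · have h1 : (d : ℤ) ∣ d * h * p.1 - p.2 := (Dvd.intro _ (by push_cast; rfl)).trans hk
      have h2 : (d : ℤ) ∣ p.2 := (dvd_sub_right (by rw [mul_assoc]; exact dvd_mul_right _ _)).mp h1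
      obtain ⟨s, hs⟩ := h2
      exact ⟨(p.1, s), Prod.ext rfl hs.symm⟩
    · rw [if_neg hk] at hp; exact absurd rfl hp

/-- The sum of `congruenceSum σ h k` over the residues `h` coprime to `k`. -/
noncomputable def coprimeCongruenceSum (σ : ℝ) : ArithmeticFunction ℝ :=
  ⟨fun k => ∑ h ∈ (Finset.Icc 1 k).filter (fun h : ℕ => Nat.Coprime h k), congruenceSum σ h k,
    by simp⟩

theorem coprimeCongruenceSum_apply (σ : ℝ) (k : ℕ) : coprimeCongruenceSum σ k =
    ∑ h ∈ (Finset.Icc 1 k).filter (fun h : ℕ => Nat.Coprime h k), congruenceSum σ h k := rfl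

/-- Group the residues `h` by `d = gcd(h, k)` and apply the scaling `congruenceSum_mul_left`. -/
theorem rpowArith_mul_coprimeCongruenceSum (σ : ℝ) {k : ℕ} (hk : 0 < k) :
    (rpowArith (-σ) * coprimeCongruenceSum σ) k =
      ∑ h ∈ Finset.Icc 1 k, congruenceSum σ h k := by
  rw [ArithmeticFunction.mul_apply,
    Nat.sum_divisorsAntidiagonal (fun a b => rpowArith (-σ) a * coprimeCongruenceSum σ b)]
  rw [← Finset.sum_fiberwise_of_maps_to (s := Finset.Icc 1 k) (t := k.divisors)
    (g := fun h => Nat.gcd h k) fun h _ => Nat.mem_divisors.mpr ⟨Nat.gcd_dvd_right h k, hk.ne'⟩]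
  refine Finset.sum_congr rfl fun d hd => ?_
  obtain ⟨k', rfl⟩ := (Nat.mem_divisors.mp hd).1
  have hd0 : 0 < d := Nat.pos_of_mem_divisors hd
  rw [Nat.mul_div_cancel_left _ hd0, coprimeCongruenceSum_apply, Finset.mul_sum,
    rpowArith_apply hd0.ne']
  refine Finset.sum_bij' (fun h _ => d * h) (fun h _ => h / d) ?_ ?_ ?_ ?_ ?_
  · intro h hh
    simp only [Finset.mem_filter, Finset.mem_Icc] at hh ⊢
    refine ⟨⟨Nat.mul_pos hd0 hh.1.1, Nat.mul_le_mul_left _ hh.1.2⟩, ?_⟩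
    rw [Nat.gcd_mul_left, hh.2, mul_one]
  · intro h hh
    simp only [Finset.mem_filter, Finset.mem_Icc] at hh ⊢
    have hdh : d ∣ h := hh.2 ▸ Nat.gcd_dvd_left h (d * k')
    obtain ⟨h', rfl⟩ := hdh
    rw [Nat.mul_div_cancel_left _ hd0]
    rw [Nat.gcd_mul_left] at hh
    exact ⟨⟨Nat.pos_of_mul_pos_left hh.1.1, Nat.le_of_mul_le_mul_left hh.1.2 hd0⟩,
      Nat.eq_of_mul_eq_mul_left hd0 (hh.2.trans (mul_one d).symm)⟩
  · intro h _
    exact Nat.mul_div_cancel_left _ hd0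
  · intro h hh
    simp only [Finset.mem_filter] at hh
    exact Nat.mul_div_cancel' (hh.2 ▸ Nat.gcd_dvd_left h (d * k'))
  · intro h _
    push_cast
    rw [congruenceSum_mul_left hd0.ne']

/-- The Dirichlet convolution formula for the sums over coprime residues. -/
theorem coprimeCongruenceSum_eq {σ : ℝ} (hσ : 1 < σ) :
    coprimeCongruenceSum σ = (2 * zetaSum σ ^ 2) • ((ArithmeticFunction.zeta : ArithmeticFunction ℝ) *
        (moebiusRpow (-σ) * (moebiusRpow (-σ) * rpowArith (1 - 2 * σ)))) := by
  have h1 : rpowArith (-σ) * coprimeCongruenceSum σ =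
      (2 * zetaSum σ ^ 2) • ((ArithmeticFunction.zeta : ArithmeticFunction ℝ) *
        (moebiusRpow (-σ) * rpowArith (1 - 2 * σ))) := by
    ext k
    rcases Nat.eq_zero_or_pos k with rfl | hk
    · simp
    · rw [rpowArith_mul_coprimeCongruenceSum σ hk, sum_congruenceSum hσ hk, tsum_gcd_rpow hσ hk]
      rw [ArithmeticFunction.smul_map, smul_eq_mul]
      ring
  have h2 : coprimeCongruenceSum σ =
      moebiusRpow (-σ) * (rpowArith (-σ) * coprimeCongruenceSum σ) := by
    rw [← mul_assoc, moebiusRpow_mul_rpowArith, one_mul]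
  rw [h2, h1, mul_smul_comm, ← mul_assoc, mul_comm (moebiusRpow (-σ)), mul_assoc]

/-! ### Dirichlet series of the main term, and uniqueness. -/

theorem LSeriesHasSum.arithmeticFunction_mul {f g : ArithmeticFunction ℝ} {s a b : ℂ}
    (hf : LSeriesHasSum (fun k => (f k : ℂ)) s a) (hg : LSeriesHasSum (fun k => (g k : ℂ)) s b) :
    LSeriesHasSum (fun k => ((f * g) k : ℂ)) s (a * b) := by
  have h := hf.convolution hg
  rw [LSeries.convolution_def] at h
  refine (LSeriesHasSum_congr s _ ?_).mp h
  intro n _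
  simp [ArithmeticFunction.mul_apply]

theorem LSeriesHasSum.pmul_rpowArith {f : ArithmeticFunction ℝ} {s a : ℂ} (e : ℝ)
    (hf : LSeriesHasSum (fun k => (f k : ℂ)) (s - e) a) :
    LSeriesHasSum (fun k => (f.pmul (rpowArith e) k : ℂ)) s a := by
  unfold LSeriesHasSum at hf ⊢
  convert hf using 1
  funext n
  rcases eq_or_ne n 0 with rfl | hn
  · simp
  · have hn' : (n : ℂ) ≠ 0 := by exact_mod_cast hn
    rw [LSeries.term_of_ne_zero hn, LSeries.term_of_ne_zero hn, ArithmeticFunction.pmul_apply,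
      rpowArith_apply hn, Complex.ofReal_mul, Complex.ofReal_cpow (by positivity),
      Complex.cpow_sub _ _ hn', Complex.ofReal_natCast, div_div_eq_mul_div]

theorem LSeriesHasSum_natCoe_zeta {s : ℂ} (hs : 1 < s.re) :
    LSeriesHasSum (fun k => ((ArithmeticFunction.zeta : ArithmeticFunction ℝ) k : ℂ)) s
      (riemannZeta s) := by
  refine (LSeriesHasSum_congr s _ ?_).mp (ArithmeticFunction.LSeriesHasSum_zeta hs)
  intro n _
  simp [ArithmeticFunction.natCoe_apply, apply_ite (Complex.ofReal)]

theorem LSeriesHasSum_intCoe_moebius {s : ℂ} (hs : 1 < s.re) :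
    LSeriesHasSum (fun k => ((ArithmeticFunction.moebius : ArithmeticFunction ℝ) k : ℂ)) s
      (riemannZeta s)⁻¹ := by
  have h1 := (ArithmeticFunction.LSeriesSummable_moebius_iff.mpr hs).LSeriesHasSum
  have h2 := ArithmeticFunction.LSeries_zeta_mul_Lseries_moebius hs
  rw [ArithmeticFunction.LSeries_zeta_eq_riemannZeta hs] at h2
  rw [eq_inv_of_mul_eq_one_right h2] at h1
  refine (LSeriesHasSum_congr s _ ?_).mp h1
  intro n _
  simp [ArithmeticFunction.intCoe_apply]

theorem LSeriesHasSum_rpowArith {s : ℂ} {e : ℝ} (hs : 1 < (s - e).re) :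
    LSeriesHasSum (fun k => (rpowArith e k : ℂ)) s (riemannZeta (s - e)) := by
  have := (LSeriesHasSum_natCoe_zeta hs).pmul_rpowArith e
  rwa [ArithmeticFunction.zeta_pmul] at this

theorem LSeriesHasSum_moebiusRpow {s : ℂ} {e : ℝ} (hs : 1 < (s - e).re) :
    LSeriesHasSum (fun k => (moebiusRpow e k : ℂ)) s (riemannZeta (s - e))⁻¹ :=
  (LSeriesHasSum_intCoe_moebius hs).pmul_rpowArith e

theorem riemannZeta_ofReal {σ : ℝ} (hσ : 1 < σ) : riemannZeta (σ : ℂ) = (zetaSum σ : ℂ) := by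
  rw [zeta_eq_tsum_one_div_nat_cpow (by simpa using hσ), zetaSum, Complex.ofReal_tsum]
  refine tsum_congr fun n => ?_
  rw [Complex.ofReal_cpow (by positivity), Complex.ofReal_natCast, Complex.ofReal_neg,
    Complex.cpow_neg, one_div]

/-- The arithmetic function whose Dirichlet series is `2 ζ(2m)² ζ(s + 4m - 1) ζ(s) /
(ζ(4m) ζ(s + 2m)²)`. -/
noncomputable def momentFactor (m : ℕ) : ArithmeticFunction ℝ :=
  (zetaSum (4 * m))⁻¹ • coprimeCongruenceSum (2 * m)

theorem hasMomentFactorSeries_momentFactor {m : ℕ} (hm : 1 ≤ m) :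
    HasMomentFactorSeries m (momentFactor m) := by
  intro s hs
  have hm' : (1 : ℝ) ≤ m := by exact_mod_cast hm
  have hσ : 1 < 2 * (m : ℝ) := by linarith
  have h1 := LSeriesHasSum_natCoe_zeta hs
  have h2 : LSeriesHasSum (fun k => (moebiusRpow (-(2 * m)) k : ℂ)) s
      (riemannZeta (s - ((-(2 * m) : ℝ) : ℂ)))⁻¹ := LSeriesHasSum_moebiusRpow (by
    simp only [Complex.sub_re, Complex.ofReal_re]; linarith)
  have h3 : LSeriesHasSum (fun k => (rpowArith (1 - 2 * (2 * m)) k : ℂ)) s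
      (riemannZeta (s - ((1 - 2 * (2 * m) : ℝ) : ℂ))) := LSeriesHasSum_rpowArith (by
    simp only [Complex.sub_re, Complex.ofReal_re]; linarith)
  have h4 := ((h1.arithmeticFunction_mul (h2.arithmeticFunction_mul
    (h2.arithmeticFunction_mul h3))).smul
      (((zetaSum (4 * m))⁻¹ * (2 * zetaSum (2 * m) ^ 2) : ℝ) : ℂ))
  have z1 : riemannZeta (2 * (m : ℂ)) = (zetaSum (2 * m) : ℂ) := by
    rw [← riemannZeta_ofReal hσ]; push_cast; rfl
  have z2 : riemannZeta (4 * (m : ℂ)) = (zetaSum (4 * m) : ℂ) := by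
    rw [← riemannZeta_ofReal (by linarith)]; push_cast; rfl
  have e1 : s - ((-(2 * m) : ℝ) : ℂ) = s + 2 * m := by push_cast; ring
  have e2 : s - ((1 - 2 * (2 * m) : ℝ) : ℂ) = s + 4 * m - 1 := by push_cast; ring
  rw [e1, e2] at h4
  rw [z1, z2]
  convert (LSeriesHasSum_congr s _ ?_).mp h4 using 1
  · rw [div_eq_mul_inv, mul_inv]
    push_cast
    ring
  · intro n _
    rw [momentFactor, coprimeCongruenceSum_eq hσ, ArithmeticFunction.smul_map,
      ArithmeticFunction.smul_map]
    simp only [Pi.smul_apply, smul_eq_mul]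
    push_cast
    ring

theorem HasMomentFactorSeries.unique {m : ℕ} {f g : ArithmeticFunction ℝ}
    (hf : HasMomentFactorSeries m f) (hg : HasMomentFactorSeries m g) : f = g := by
  have hab : ∀ {F : ArithmeticFunction ℝ}, HasMomentFactorSeries m F →
      LSeries.abscissaOfAbsConv (fun k => (F k : ℂ)) < ⊤ := by
    intro F hF
    refine lt_of_le_of_lt (LSeriesSummable.abscissaOfAbsConv_le (s := 2)
      (hF 2 (by norm_num)).LSeriesSummable) ?_
    exact EReal.coe_lt_top _
  ext n
  rcases eq_or_ne n 0 with rfl | hn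
  · simp
  have := LSeries.eq_of_LSeries_eventually_eq (hab hf) (hab hg) (by
    filter_upwards [Filter.eventually_gt_atTop (1 : ℝ)] with x hx
    rw [(hf x (by simpa using hx)).LSeries_eq, (hg x (by simpa using hx)).LSeries_eq]) hn
  exact_mod_cast this

/-! ### Pointwise comparison of the power with the congruence sum. -/

/-- For `n` at least of order `√k`, the exponent `2m` is traded for a smaller `σ` at the cost `k ^
(m + σ / 2)`. The choice `σ = 3 / 2` exceeds `1`, so the weights stay summable, and for `m = 1` it
gives `k ^ (7 / 4)`, below `k ^ (9 / 5)`. -/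
theorem rpow_neg_le_of_le_sq {m : ℕ} (hm : 1 ≤ m) {n k : ℝ} (hn : 0 < n) (hk : 0 < k)
    (h : k ≤ 4 * n ^ 2) :
    k ^ (2 * m) * n ^ (-(2 * m : ℝ)) ≤
      2 ^ (2 * m) * k ^ ((m : ℝ) + 3 / 4) * n ^ (-(3 / 2) : ℝ) := by
  have hm' : (1 : ℝ) ≤ m := by exact_mod_cast hm
  have h1 : k ^ ((m : ℝ) - 3 / 4) ≤ 2 ^ (2 * m) * n ^ (2 * (m : ℝ) - 3 / 2) := by
    calc k ^ ((m : ℝ) - 3 / 4) ≤ ((2 * n) ^ (2 : ℝ)) ^ ((m : ℝ) - 3 / 4) := by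
          apply Real.rpow_le_rpow hk.le _ (by linarith)
          rw [Real.rpow_two]; linarith
      _ = 2 ^ (2 * (m : ℝ) - 3 / 2) * n ^ (2 * (m : ℝ) - 3 / 2) := by
          rw [← Real.rpow_mul (by positivity), Real.mul_rpow (by norm_num) hn.le]
          ring_nf
      _ ≤ 2 ^ (2 * (m : ℝ)) * n ^ (2 * (m : ℝ) - 3 / 2) := by
          gcongr
          · norm_num
          · linarith
      _ = _ := by
          congr 1
          rw [← Real.rpow_natCast]; push_cast; rfl
  have e1 : k ^ (2 * m) = k ^ ((m : ℝ) - 3 / 4) * k ^ ((m : ℝ) + 3 / 4) := by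
    rw [← Real.rpow_add hk, ← Real.rpow_natCast]
    congr 1; push_cast; ring
  have e2 : n ^ (-(3 / 2) : ℝ) = n ^ (2 * (m : ℝ) - 3 / 2) * n ^ (-(2 * m : ℝ)) := by
    rw [← Real.rpow_add hn]
    congr 1; ring
  rw [e1, e2]
  have := mul_le_mul_of_nonneg_right h1
    (show 0 ≤ k ^ ((m : ℝ) + 3 / 4) * n ^ (-(2 * m : ℝ)) by positivity)
  linarith

theorem tsum_tail_le {m : ℕ} (hm : 1 ≤ m) {h : ℤ} {k : ℕ} (hk : 0 < k) (P : ℕ × ℤ → Prop)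
    [DecidablePred P]
    (hP : ∀ p, P p → (k : ℤ) ∣ h * p.1 - p.2)
    (hP' : ∀ p, P p → p.1 ≠ 0 → p.2 ≠ 0 → (k : ℝ) ≤ 4 * ((p.1 : ℝ) * |(p.2 : ℝ)|) ^ 2) :
    (k : ℝ) ^ (2 * m) * ∑' p : ℕ × ℤ, (if P p then ((p.1 : ℝ) * |(p.2 : ℝ)|) ^ (-(2 * m : ℝ)) else 0)
      ≤ 2 ^ (2 * m) * (k : ℝ) ^ ((m : ℝ) + 3 / 4) * congruenceSum (3 / 2) h k := by
  have hm' : (1 : ℝ) ≤ m := by exact_mod_cast hm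
  rw [congruenceSum, ← tsum_mul_left, ← tsum_mul_left]
  refine Summable.tsum_le_tsum (fun p => ?_) ((summable_pair_ite (by linarith) _).mul_left _)
    ((summable_pair_ite (by norm_num) _).mul_left _)
  by_cases hp : P p
  · rw [if_pos hp, if_pos (hP p hp)]
    -- Degenerate pairs have weight `0`, as `0` to a nonzero real power is `0`.
    by_cases h0 : p.1 = 0 ∨ p.2 = 0
    · have : (p.1 : ℝ) * |(p.2 : ℝ)| = 0 := by
        rcases h0 with h0 | h0 <;> simp [h0]
      rw [this, Real.zero_rpow (by linarith)]
      simp only [mul_zero]; positivity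
    · push Not at h0
      refine rpow_neg_le_of_le_sq hm ?_ (by exact_mod_cast hk) (hP' p hp h0.1 h0.2)
      have := abs_pos.mpr (Int.cast_ne_zero.mpr h0.2 : (p.2 : ℝ) ≠ 0)
      have := Nat.pos_of_ne_zero h0.1
      positivity
  · rw [if_neg hp, mul_zero]
    split_ifs <;> positivity

theorem rpow_le_congruenceSum {σ : ℝ} (hσ : 1 < σ) {h : ℤ} {k : ℕ} {q : ℕ} {r : ℤ}
    (hv : (k : ℤ) ∣ h * q - r) : ((q : ℝ) * |(r : ℝ)|) ^ (-σ) ≤ congruenceSum σ h k := by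
  have := (summable_pair_ite hσ fun p : ℕ × ℤ => (k : ℤ) ∣ h * p.1 - p.2).le_tsum (q, r)
    (fun p _ => by split_ifs <;> positivity)
  rwa [if_pos hv] at this

theorem one_le_zetaSum {σ : ℝ} (hσ : 1 < σ) : 1 ≤ zetaSum σ := by
  have := (summable_natCast_rpow hσ).le_tsum 1 (fun n _ => by positivity)
  simpa [zetaSum] using this

theorem one_le_mul_abs {q : ℕ} {r : ℤ} (hq : q ≠ 0) (hr : r ≠ 0) : (1 : ℝ) ≤ q * |(r : ℝ)| := by
  have h1 : (1 : ℝ) ≤ q := by exact_mod_cast Nat.one_le_iff_ne_zero.mpr hq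
  nlinarith [one_le_abs_intCast hr]

theorem dedekindSum_pow_le_of_minor {m : ℕ} (hm : 1 ≤ m) {h k : ℕ} (hh : 0 < h) (hhk : h ≤ k)
    (hc : Nat.Coprime h k) (hk : 3 ≤ k)
    (hmin : ∀ (q : ℕ) (r : ℤ), q ≠ 0 → r ≠ 0 → (k : ℤ) ∣ h * q - r →
      (k : ℝ) ≤ 4 * ((q : ℝ) * |(r : ℝ)|) ^ 2) :
    (12 * dedekindSum h k) ^ (2 * m) ≤
      60 ^ (2 * m) * Real.log k ^ (2 * m) * (k : ℝ) ^ ((m : ℝ) + 3 / 4) *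
        congruenceSum (3 / 2) h k := by
  have hk0 : (0 : ℝ) < k := by positivity
  -- A pair with least product `n = q |r|` allows `M = k / n` in the Euclidean bound; `(1, h)` shows
  -- that pairs exist.
  obtain ⟨⟨q, r⟩, ⟨hq, hr, hv⟩, hmn⟩ := WellFounded.has_min
    (measure fun p : ℕ × ℤ => p.1 * p.2.natAbs).wf
    {p : ℕ × ℤ | p.1 ≠ 0 ∧ p.2 ≠ 0 ∧ (k : ℤ) ∣ h * p.1 - p.2} ⟨(1, h), by simp; omega⟩
  simp only at hq hr hv
  have hn := one_le_mul_abs hq hr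
  set n : ℝ := q * |(r : ℝ)| with hn_def
  have hM : ∀ (q' : ℕ) (r' : ℤ), q' ≠ 0 → r' ≠ 0 → (k : ℤ) ∣ h * q' - r' →
      (k : ℝ) ≤ k / n * (q' * |(r' : ℝ)|) := by
    intro q' r' hq' hr' hv'
    have h1 := hmn (q', r') ⟨hq', hr', hv'⟩
    have h2 : q * r.natAbs ≤ q' * r'.natAbs := not_lt.mp h1
    have h3 : n ≤ q' * |(r' : ℝ)| := by
      rw [hn_def]
      have : (q : ℝ) * (r.natAbs : ℝ) ≤ q' * (r'.natAbs : ℝ) := by exact_mod_cast h2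
      rwa [Nat.cast_natAbs, Nat.cast_natAbs, Int.cast_abs, Int.cast_abs] at this
    rw [div_mul_eq_mul_div, le_div_iff₀ (by linarith)]
    gcongr
  have h1 := abs_dedekindSum_le_log hh hhk hc hk hM
  have h2 : (12 * dedekindSum h k) ^ (2 * m) ≤ (30 * (k / n) * Real.log k) ^ (2 * m) := by
    rw [← Even.pow_abs (even_two_mul m)]
    exact pow_le_pow_left₀ (abs_nonneg _) h1 _
  have h3 := rpow_neg_le_of_le_sq hm (by linarith : 0 < n) hk0 (hmin q r hq hr hv)
  have h4 := rpow_le_congruenceSum (σ := 3 / 2) (by norm_num) hv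
  have h5 : (k / n) ^ (2 * m) = k ^ (2 * m) * n ^ (-(2 * m : ℝ)) := by
    rw [div_pow, Real.rpow_neg (by linarith), ← Real.rpow_natCast n, div_eq_mul_inv]
    push_cast; rfl
  have hlog : 0 ≤ Real.log k := Real.log_natCast_nonneg k
  calc _ ≤ _ := h2
    _ = 30 ^ (2 * m) * Real.log k ^ (2 * m) * (k / n) ^ (2 * m) := by
        rw [mul_pow, mul_pow]; ring
    _ ≤ 30 ^ (2 * m) * Real.log k ^ (2 * m) *
        (2 ^ (2 * m) * (k : ℝ) ^ ((m : ℝ) + 3 / 4) * congruenceSum (3 / 2) h k) := by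
        rw [h5]
        exact mul_le_mul_of_nonneg_left (h3.trans (by gcongr)) (by positivity)
    _ = _ := by
        rw [show (60 : ℝ) = 30 * 2 by norm_num, mul_pow]; ring

/-- Writing `r = q h - a k`, a common factor of `q` and `a` also divides `r` and can be removed. -/
theorem exists_primitive_pair {h k q : ℕ} {r : ℤ} (hq : q ≠ 0) (hr : r ≠ 0)
    (hv : (k : ℤ) ∣ h * q - r) :
    ∃ (q₀ : ℕ) (a₀ r₀ : ℤ), q₀ ≠ 0 ∧ r₀ ≠ 0 ∧ IsCoprime a₀ q₀ ∧ q₀ * (h : ℤ) - a₀ * k = r₀ ∧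
      (q₀ : ℝ) * |(r₀ : ℝ)| ≤ q * |(r : ℝ)| := by
  obtain ⟨a, ha⟩ := hv
  have hg : 0 < Int.gcd q a := Int.gcd_pos_of_ne_zero_left _ (by exact_mod_cast hq)
  obtain ⟨g, q', a', hg0, hco, hq', ha'⟩ := Int.exists_gcd_one' hg
  have hq0 : (0 : ℤ) < q' := by
    have : 0 < q' * (g : ℤ) := by rw [← hq']; positivity
    exact pos_of_mul_pos_left this (by positivity)
  lift q' to ℕ using hq0.le
  have hr' : r = (q' * h - a' * k) * g := by
    have : r = h * q - k * a := by linarith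
    rw [this, ha', hq']; ring
  refine ⟨q', a', q' * h - a' * k, by rintro rfl; simp at hq0, ?_,
    (Int.isCoprime_iff_gcd_eq_one.mpr hco).symm, rfl, ?_⟩
  · intro h0; rw [h0, zero_mul] at hr'; exact hr hr'
  · have hqR : (q : ℝ) = q' * g := by exact_mod_cast hq'
    rw [hr', hqR]
    push_cast
    rw [abs_mul, Nat.abs_cast]
    have hg1 : (1 : ℝ) ≤ g := by exact_mod_cast hg0
    have hx : 0 ≤ (q' : ℝ) * |(q' : ℝ) * h - a' * k| := by positivity
    calc _ ≤ (q' : ℝ) * |(q' : ℝ) * h - a' * k| * (g * g) :=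
          le_mul_of_one_le_right hx (by nlinarith)
      _ = _ := by ring

/-- By coprimality of `a₀` and `q₀`, the solutions proportional to `(q₀, r₀)` are the multiples `(g
q₀, g r₀)`, and their weights carry the factor `g ^ (-4m)`. -/
theorem tsum_proportional {m : ℕ} {h k q₀ : ℕ} {a₀ r₀ : ℤ} (hk : 0 < k)
    (hq : q₀ ≠ 0) (haq : IsCoprime a₀ q₀) (hdet : q₀ * (h : ℤ) - a₀ * k = r₀) :
    ∑' p : ℕ × ℤ, (if (k : ℤ) ∣ h * p.1 - p.2 ∧ p.1 * r₀ = p.2 * q₀ then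
      ((p.1 : ℝ) * |(p.2 : ℝ)|) ^ (-(2 * m : ℝ)) else 0) =
      zetaSum (4 * m) * ((q₀ : ℝ) * |(r₀ : ℝ)|) ^ (-(2 * m : ℝ)) := by
  have hinj : Function.Injective fun g : ℕ => (g * q₀, (g : ℤ) * r₀) := by
    intro a b hab
    simp only [Prod.mk.injEq] at hab
    exact Nat.eq_of_mul_eq_mul_right (Nat.pos_of_ne_zero hq) hab.1
  rw [← hinj.tsum_eq, zetaSum, ← tsum_mul_right]
  · refine tsum_congr fun g => ?_
    rw [if_pos]
    · push_cast
      rw [abs_mul, Nat.abs_cast, show (g : ℝ) * q₀ * (g * |(r₀ : ℝ)|) = (g : ℝ) ^ (2 : ℝ) * (q₀ * |(r₀ : ℝ)|) by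
        rw [Real.rpow_two]; ring, Real.mul_rpow (by positivity) (by positivity),
        ← Real.rpow_mul (by positivity)]
      congr 2; ring
    · constructor
      · refine ⟨g * a₀, ?_⟩
        push_cast
        linear_combination (g : ℤ) * hdet
      · push_cast; ring
  · intro p hp
    rw [Function.mem_support] at hp
    by_cases hc : (k : ℤ) ∣ h * p.1 - p.2 ∧ p.1 * r₀ = p.2 * q₀
    · obtain ⟨⟨a, ha⟩, hprop⟩ := hc
      have hk' : (k : ℤ) ≠ 0 := by omega
      have h1 : (p.1 : ℤ) * a₀ = q₀ * a := by
        apply mul_left_cancel₀ hk'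
        linear_combination (p.1 : ℤ) * hdet.symm + hprop * (-1) + (q₀ : ℤ) * ha
      have h2 : (q₀ : ℤ) ∣ p.1 := haq.symm.dvd_of_dvd_mul_right ⟨a, h1⟩
      obtain ⟨g, hg⟩ := Int.natCast_dvd_natCast.mp h2
      have hq' : (q₀ : ℤ) ≠ 0 := by exact_mod_cast hq
      refine ⟨g, Prod.ext ?_ ?_⟩
      · simp only; rw [hg, mul_comm]
      · simp only
        apply mul_right_cancel₀ hq'
        rw [← hprop, hg]; push_cast; ring
    · rw [if_neg hc] at hp; exact absurd rfl hp

/-- The determinant `q r₀ - r q₀` is a nonzero multiple of `k`, which forces `k ≤ 2 n n₀` for the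
two products `n = q |r|` and `n₀ = q₀ |r₀|`; as `n₀` is at most of order `√k`, `n` is at least of
that order. -/
theorem le_sq_of_not_proportional {h k q₀ q : ℕ} {a₀ r₀ r : ℤ} (hk : 2 ≤ k)
    (hq₀ : q₀ ≠ 0) (hr₀ : r₀ ≠ 0) (hdet : q₀ * (h : ℤ) - a₀ * k = r₀)
    (hsmall : 4 * ((q₀ : ℝ) * |(r₀ : ℝ)|) ^ 2 ≤ k) (hq : q ≠ 0) (hr : r ≠ 0)
    (hv : (k : ℤ) ∣ h * q - r) (hne : q * r₀ ≠ r * q₀) :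
    (k : ℝ) ≤ 4 * ((q : ℝ) * |(r : ℝ)|) ^ 2 := by
  obtain ⟨a, ha⟩ := hv
  have hd : (k : ℤ) ∣ q * r₀ - r * q₀ :=
    ⟨q₀ * a - q * a₀, by linear_combination (q : ℤ) * hdet.symm + (q₀ : ℤ) * ha⟩
  have h1 : (k : ℤ) ≤ |q * r₀ - r * q₀| :=
    Int.le_of_dvd (abs_pos.mpr (sub_ne_zero.mpr hne)) ((dvd_abs _ _).mpr hd)
  have h2 : (k : ℝ) ≤ q * |(r₀ : ℝ)| + |(r : ℝ)| * q₀ := by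
    have h3 : (k : ℝ) ≤ |(q : ℝ) * r₀ - r * q₀| := by exact_mod_cast h1
    refine h3.trans ((abs_sub _ _).trans ?_)
    rw [abs_mul, abs_mul, Nat.abs_cast, Nat.abs_cast]
  have x1 := one_le_mul_abs hq hr₀
  have x2 := one_le_mul_abs hq₀ hr
  have hk' : (2 : ℝ) ≤ k := by exact_mod_cast hk
  set n₀ := (q₀ : ℝ) * |(r₀ : ℝ)| with hn₀
  set n := (q : ℝ) * |(r : ℝ)| with hn
  have h4 : (k : ℝ) / 2 ≤ n * n₀ := by
    have : n * n₀ = (q * |(r₀ : ℝ)|) * (q₀ * |(r : ℝ)|) := by rw [hn, hn₀]; ring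
    rw [this]; nlinarith
  have h5 : (k : ℝ) ^ 2 ≤ 4 * n ^ 2 * n₀ ^ 2 := by
    have := pow_le_pow_left₀ (by positivity) h4 2
    nlinarith
  have h6 : (k : ℝ) * k ≤ k * n ^ 2 := by nlinarith [sq_nonneg n]
  have := le_of_mul_le_mul_left h6 (by linarith)
  nlinarith

/-- The left side is `k ^ (2m - 1) n ^ (2 - 2m)`. For `m ≥ 2` the decay in `n` already beats `n ^
(-3/2)`; for `m = 1` there is none, and `n ^ (3/2) ≤ k ^ (3/4)` supplies it. -/
theorem pow_mul_rpow_le {m : ℕ} (hm : 1 ≤ m) {n k : ℝ} (hn : 1 ≤ n) (hk : 4 * n ^ 2 ≤ k) :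
    n * (k / n) ^ (2 * m - 1) ≤
      (k ^ ((m : ℝ) + 3 / 4) + k ^ (2 * (m : ℝ) - 1)) * n ^ (-(3 / 2) : ℝ) := by
  have hn0 : 0 < n := by linarith
  have hk0 : 0 < k := by nlinarith
  rw [add_mul]
  rcases hm.eq_or_lt with rfl | hm2
  · have h1 : n ^ (3 / 2 : ℝ) ≤ k ^ (3 / 4 : ℝ) := by
      calc n ^ (3 / 2 : ℝ) = (n ^ (2 : ℝ)) ^ (3 / 4 : ℝ) := by
            rw [← Real.rpow_mul hn0.le]; norm_num
        _ ≤ _ := by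
            apply Real.rpow_le_rpow (by positivity) _ (by norm_num)
            rw [Real.rpow_two]; nlinarith
    have h2 : k ≤ k ^ (((1 : ℕ) : ℝ) + 3 / 4) * n ^ (-(3 / 2) : ℝ) := by
      rw [Real.rpow_neg hn0.le, ← div_eq_mul_inv, le_div_iff₀ (by positivity), Nat.cast_one,
        Real.rpow_add hk0, Real.rpow_one]
      gcongr
    have h3 : n * (k / n) ^ (2 * 1 - 1) = k := by
      norm_num; field_simp
    rw [h3]
    exact h2.trans (le_add_of_nonneg_right (by positivity))
  · have hm' : (2 : ℝ) ≤ m := by exact_mod_cast hm2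
    refine le_trans ?_ (le_add_of_nonneg_left (by positivity))
    have e : ((2 * m - 1 : ℕ) : ℝ) = 2 * (m : ℝ) - 1 := by
      rw [Nat.cast_sub (by omega)]; push_cast; ring
    rw [← Real.rpow_natCast, e, Real.div_rpow hk0.le hn0.le, div_eq_mul_inv, ← Real.rpow_neg hn0.le,
      mul_left_comm]
    gcongr
    nth_rewrite 1 [← Real.rpow_one n]
    rw [← Real.rpow_add hn0]
    exact Real.rpow_le_rpow_of_exponent_le hn (by linarith)

theorem abs_pow_sub_le_of_major {m : ℕ} (hm : 1 ≤ m) {D A n k : ℝ} (hn : 1 ≤ n)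
    (hk : 4 * n ^ 2 ≤ k) (hA : |A| = k / n) (hD : |D - A| ≤ 11 * n) :
    |D ^ (2 * m) - A ^ (2 * m)| ≤ 22 * m * 4 ^ (2 * m - 1) *
      ((k ^ ((m : ℝ) + 3 / 4) + k ^ (2 * (m : ℝ) - 1)) * n ^ (-(3 / 2) : ℝ)) := by
  have hn0 : 0 < n := by linarith
  have h1 : 4 * n ≤ k / n := by rw [le_div_iff₀ hn0]; linarith
  have h2 : |D| ≤ 4 * (k / n) := by
    have := abs_sub_abs_le_abs_sub D A
    linarith
  have h3 : max |D| |A| ≤ 4 * (k / n) := max_le h2 (by rw [hA]; linarith)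
  have h4 := abs_pow_sub_pow_le D A (2 * m)
  calc _ ≤ _ := h4
    _ ≤ 11 * n * (2 * m : ℕ) * (4 * (k / n)) ^ (2 * m - 1) := by
        gcongr
    _ = 22 * m * 4 ^ (2 * m - 1) * (n * (k / n) ^ (2 * m - 1)) := by
        rw [mul_pow]; push_cast; ring
    _ ≤ _ := mul_le_mul_of_nonneg_left (pow_mul_rpow_le hm hn hk) (by positivity)

theorem abs_dedekindSum_pow_sub_le {m : ℕ} (hm : 1 ≤ m) {h k : ℕ} (hh : 0 < h) (hhk : h ≤ k)
    (hc : Nat.Coprime h k) (hk : 3 ≤ k) :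
    |(12 * dedekindSum h k) ^ (2 * m) -
        (k : ℝ) ^ (2 * m) * ((zetaSum (4 * m))⁻¹ * congruenceSum (2 * m) h k)| ≤
      (60 ^ (2 * m) + 2 ^ (2 * m) + 22 * m * 4 ^ (2 * m - 1)) * Real.log k ^ (2 * m) *
        ((k : ℝ) ^ ((m : ℝ) + 3 / 4) + (k : ℝ) ^ (2 * (m : ℝ) - 1)) *
          congruenceSum (3 / 2) h k := by
  classical
  have hm' : (1 : ℝ) ≤ m := by exact_mod_cast hm
  have hk0 : (0 : ℝ) < k := by positivity
  have hz : 1 ≤ zetaSum (4 * m) := one_le_zetaSum (by linarith)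
  have hE := congruenceSum_nonneg (3 / 2) h k
  have hL : 1 ≤ Real.log k ^ (2 * m) := by
    apply one_le_pow₀
    rw [Real.le_log_iff_exp_le hk0]
    have := Real.exp_one_lt_d9
    have : (3 : ℝ) ≤ k := by exact_mod_cast hk
    linarith
  set E := congruenceSum (3 / 2) h k
  set L := Real.log k ^ (2 * m)
  set W₁ := (k : ℝ) ^ ((m : ℝ) + 3 / 4) with hW₁
  set W₂ := (k : ℝ) ^ (2 * (m : ℝ) - 1) with hW₂
  have hW₁0 : 0 ≤ W₁ := by positivity
  have hW₂0 : 0 ≤ W₂ := by positivity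
  have htail : ∀ T : ℝ, 0 ≤ T → (k : ℝ) ^ (2 * m) * T ≤ 2 ^ (2 * m) * W₁ * E →
      |(k : ℝ) ^ (2 * m) * ((zetaSum (4 * m))⁻¹ * T)| ≤ 2 ^ (2 * m) * W₁ * E := by
    intro T hT hle
    rw [abs_of_nonneg (by positivity)]
    refine le_trans ?_ hle
    gcongr
    exact mul_le_of_le_one_left hT (inv_le_one_of_one_le₀ hz)
  have hW : W₁ * E ≤ L * (W₁ + W₂) * E := by
    gcongr
    nlinarith
  by_cases hmaj : ∃ (q : ℕ) (r : ℤ), q ≠ 0 ∧ r ≠ 0 ∧ (k : ℤ) ∣ h * q - r ∧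
      4 * ((q : ℝ) * |(r : ℝ)|) ^ 2 < k
  · obtain ⟨q, r, hq, hr, hv, hsm⟩ := hmaj
    obtain ⟨q₀, a₀, r₀, hq₀, hr₀, haq, hdet, hle⟩ := exists_primitive_pair hq hr hv
    have hn := one_le_mul_abs hq₀ hr₀
    have hsm₀ : 4 * ((q₀ : ℝ) * |(r₀ : ℝ)|) ^ 2 ≤ k := by
      have := pow_le_pow_left₀ (by positivity) hle 2
      linarith
    have hv₀ : (k : ℤ) ∣ h * q₀ - r₀ := ⟨a₀, by linear_combination hdet⟩
    -- The multiples of the primitive pair form the main term; all other pairs fall under the tail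
    -- bound.
    have hsplit : congruenceSum (2 * m) h k =
        zetaSum (4 * m) * ((q₀ : ℝ) * |(r₀ : ℝ)|) ^ (-(2 * m : ℝ)) +
        ∑' p : ℕ × ℤ, (if (k : ℤ) ∣ h * p.1 - p.2 ∧ p.1 * r₀ ≠ p.2 * q₀ then
          ((p.1 : ℝ) * |(p.2 : ℝ)|) ^ (-(2 * m : ℝ)) else 0) := by
      rw [← tsum_proportional (by omega) hq₀ haq hdet,
        ← (summable_pair_ite (by linarith) _).tsum_add (summable_pair_ite (by linarith) _),
        congruenceSum]
      refine tsum_congr fun p => ?_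
      by_cases h1 : (k : ℤ) ∣ h * p.1 - p.2 <;> by_cases h2 : p.1 * r₀ = p.2 * q₀ <;> simp [h1, h2]
    set T := ∑' p : ℕ × ℤ, (if (k : ℤ) ∣ h * p.1 - p.2 ∧ p.1 * r₀ ≠ p.2 * q₀ then
          ((p.1 : ℝ) * |(p.2 : ℝ)|) ^ (-(2 * m : ℝ)) else 0) with hT
    have hT0 : 0 ≤ T := tsum_nonneg fun p => by split_ifs <;> positivity
    have hTle := htail T hT0 (tsum_tail_le hm (by omega)
      (fun p : ℕ × ℤ => (k : ℤ) ∣ h * p.1 - p.2 ∧ p.1 * r₀ ≠ p.2 * q₀) (fun p hp => hp.1)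
      fun p hp hp1 hp2 => le_sq_of_not_proportional (by omega) hq₀ hr₀ hdet hsm₀ hp1 hp2 hp.1 hp.2)
    have hD := abs_dedekindSum_sub_le (Nat.pos_of_ne_zero hq₀) (by omega : 0 < k) hr₀
      (Nat.isCoprime_iff_coprime.mpr hc) haq hdet
    have hA : |(k : ℝ) / (q₀ * r₀)| = k / (q₀ * |(r₀ : ℝ)|) := by
      rw [abs_div, abs_mul, Nat.abs_cast, Nat.abs_cast]
    have hmain := abs_pow_sub_le_of_major hm hn hsm₀ hA hD
    have hApow : ((k : ℝ) / (q₀ * r₀)) ^ (2 * m) =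
        (k : ℝ) ^ (2 * m) * ((q₀ : ℝ) * |(r₀ : ℝ)|) ^ (-(2 * m : ℝ)) := by
      rw [← Even.pow_abs (even_two_mul m), hA, div_pow, Real.rpow_neg (by linarith),
        ← Real.rpow_natCast ((q₀ : ℝ) * |(r₀ : ℝ)|), div_eq_mul_inv]
      push_cast; rfl
    have hnE := rpow_le_congruenceSum (σ := 3 / 2) (by norm_num) hv₀
    have e : (12 * dedekindSum h k) ^ (2 * m) -
        (k : ℝ) ^ (2 * m) * ((zetaSum (4 * m))⁻¹ * congruenceSum (2 * m) h k) =
        ((12 * dedekindSum h k) ^ (2 * m) - ((k : ℝ) / (q₀ * r₀)) ^ (2 * m)) -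
          (k : ℝ) ^ (2 * m) * ((zetaSum (4 * m))⁻¹ * T) := by
      rw [hsplit, hApow]
      have : zetaSum (4 * m) ≠ 0 := by positivity
      field_simp
      ring
    rw [e]
    have h1 : (W₁ + W₂) * ((q₀ : ℝ) * |(r₀ : ℝ)|) ^ (-(3 / 2) : ℝ) ≤ L * (W₁ + W₂) * E := by
      calc _ ≤ (W₁ + W₂) * E := by gcongr
        _ ≤ L * ((W₁ + W₂) * E) := le_mul_of_one_le_left (by positivity) hL
        _ = _ := by ring
    have h2 := mul_le_mul_of_nonneg_left h1 (show (0 : ℝ) ≤ 22 * m * 4 ^ (2 * m - 1) by positivity)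
    have h3 := mul_le_mul_of_nonneg_left hW (show (0 : ℝ) ≤ 2 ^ (2 * m) by positivity)
    have h4 : 0 ≤ 60 ^ (2 * m) * (L * (W₁ + W₂) * E) := by positivity
    have h5 := abs_sub ((12 * dedekindSum h k) ^ (2 * m) - ((k : ℝ) / (q₀ * r₀)) ^ (2 * m))
      ((k : ℝ) ^ (2 * m) * ((zetaSum (4 * m))⁻¹ * T))
    linarith
  · push Not at hmaj
    have h1 := dedekindSum_pow_le_of_minor hm hh hhk hc hk hmaj
    have h2 := htail (congruenceSum (2 * m) h k) (congruenceSum_nonneg _ _ _)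
      (tsum_tail_le hm (by omega) (fun p : ℕ × ℤ => (k : ℤ) ∣ h * p.1 - p.2) (fun p hp => hp)
        fun p hp hp1 hp2 => hmaj p.1 p.2 hp1 hp2 hp)
    have h3 := mul_le_mul_of_nonneg_left hW (show (0 : ℝ) ≤ 2 ^ (2 * m) by positivity)
    have h4 : 0 ≤ 22 * m * 4 ^ (2 * m - 1) * (L * (W₁ + W₂) * E) := by positivity
    have h5 := abs_sub ((12 * dedekindSum h k) ^ (2 * m))
      ((k : ℝ) ^ (2 * m) * ((zetaSum (4 * m))⁻¹ * congruenceSum (2 * m) h k))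
    rw [abs_of_nonneg ((even_two_mul m).pow_nonneg (12 * dedekindSum h k))] at h5
    have h6 : 60 ^ (2 * m) * L * W₁ * E ≤ 60 ^ (2 * m) * (L * (W₁ + W₂) * E) := by
      have : 0 ≤ 60 ^ (2 * m) * L * W₂ * E := by positivity
      linarith
    linarith

/-! ### Summation over `h` and the final error term. -/

theorem abs_sum_dedekindSum_pow_sub_le {m : ℕ} (hm : 1 ≤ m) {k : ℕ} (hk : 3 ≤ k) :
    |∑ h ∈ (Finset.Icc 1 k).filter (fun h : ℕ => Nat.Coprime h k),
          dedekindSum (h : ℤ) k ^ (2 * m) - momentFactor m k * ((k : ℝ) / 12) ^ (2 * m)| ≤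
      (60 ^ (2 * m) + 2 ^ (2 * m) + 22 * m * 4 ^ (2 * m - 1)) * (2 * zetaSum (3 / 2) ^ 2) *
        (((k : ℝ) ^ ((m : ℝ) + 3 / 4) + (k : ℝ) ^ (2 * (m : ℝ) - 1)) * Real.log k ^ (2 * m)) := by
  set S := (Finset.Icc 1 k).filter (fun h : ℕ => Nat.Coprime h k) with hS
  have e : ∑ h ∈ S, dedekindSum (h : ℤ) k ^ (2 * m) - momentFactor m k * ((k : ℝ) / 12) ^ (2 * m) =
      (12 ^ (2 * m))⁻¹ * ∑ h ∈ S, ((12 * dedekindSum h k) ^ (2 * m) -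
        (k : ℝ) ^ (2 * m) * ((zetaSum (4 * m))⁻¹ * congruenceSum (2 * m) h k)) := by
    rw [Finset.sum_sub_distrib, ← Finset.mul_sum, ← Finset.mul_sum, momentFactor,
      ArithmeticFunction.smul_map, coprimeCongruenceSum_apply, smul_eq_mul, mul_sub, div_pow]
    simp_rw [mul_pow]
    rw [← Finset.mul_sum, ← hS]
    field_simp
  set C : ℝ := 60 ^ (2 * m) + 2 ^ (2 * m) + 22 * m * 4 ^ (2 * m - 1)
  set W := (k : ℝ) ^ ((m : ℝ) + 3 / 4) + (k : ℝ) ^ (2 * (m : ℝ) - 1)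
  have hlog : 0 ≤ Real.log k := Real.log_natCast_nonneg k
  have h1 : |∑ h ∈ S, ((12 * dedekindSum h k) ^ (2 * m) -
        (k : ℝ) ^ (2 * m) * ((zetaSum (4 * m))⁻¹ * congruenceSum (2 * m) h k))| ≤
      C * Real.log k ^ (2 * m) * W * (2 * zetaSum (3 / 2) ^ 2) := by
    refine (Finset.abs_sum_le_sum_abs _ _).trans ?_
    refine (Finset.sum_le_sum fun h hh => ?_).trans (?_ : ∑ h ∈ S,
      C * Real.log k ^ (2 * m) * W * congruenceSum (3 / 2) h k ≤ _)
    · rw [hS, Finset.mem_filter, Finset.mem_Icc] at hh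
      exact abs_dedekindSum_pow_sub_le hm hh.1.1 hh.1.2 hh.2 hk
    · rw [← Finset.mul_sum]
      refine mul_le_mul_of_nonneg_left ?_ (by positivity)
      refine le_trans ?_ (sum_congruenceSum_le (by norm_num) (by omega : 0 < k))
      exact Finset.sum_le_sum_of_subset_of_nonneg (Finset.filter_subset _ _)
        fun h _ _ => congruenceSum_nonneg _ _ _
  rw [e, abs_mul, abs_of_nonneg (by positivity)]
  calc _ ≤ 1 * (C * Real.log k ^ (2 * m) * W * (2 * zetaSum (3 / 2) ^ 2)) := by
        refine mul_le_mul ?_ h1 (abs_nonneg _) zero_le_one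
        exact inv_le_one_of_one_le₀ (one_le_pow₀ (by norm_num))
    _ = _ := by ring

theorem rpow_mul_log_pow_isBigO {m : ℕ} (hm : 1 ≤ m) :
    (fun k : ℕ => ((k : ℝ) ^ ((m : ℝ) + 3 / 4) + (k : ℝ) ^ (2 * (m : ℝ) - 1)) *
        Real.log k ^ (2 * m)) =O[Filter.atTop]
      (fun k : ℕ =>
          ((k : ℝ) ^ (9 / 5 : ℝ) + (k : ℝ) ^ (2 * (m : ℝ) - 1 + 1 / ((m : ℝ) + 1))) *
            Real.log (k : ℝ) ^ 3) := by
  have hm' : (1 : ℝ) ≤ m := by exact_mod_cast hm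
  -- The factor `log ^ (2m)` is absorbed into `k ^ δ`: `δ ≤ 1/20 = 9/5 - 7/4` serves `m = 1`, and `δ
  -- ≤ 1 / (m + 1)` serves the other exponent.
  set δ : ℝ := 1 / (20 * ((m : ℝ) + 1)) with hδ
  have hδ0 : 0 < δ := by positivity
  have hδ1 : δ ≤ 1 / 20 := by
    rw [hδ]; apply one_div_le_one_div_of_le <;> nlinarith
  have hδ2 : δ ≤ 1 / ((m : ℝ) + 1) := by
    rw [hδ]; apply one_div_le_one_div_of_le <;> nlinarith
  have hlo := ((isLittleO_log_rpow_rpow_atTop ((2 * m : ℕ) : ℝ) hδ0).comp_tendsto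
    tendsto_natCast_atTop_atTop).bound one_pos
  refine Asymptotics.IsBigO.of_bound 2 ?_
  filter_upwards [hlo, Filter.eventually_ge_atTop 3] with k hk hk3
  have hk0 : (0 : ℝ) < k := by positivity
  have hk1 : (1 : ℝ) ≤ k := by exact_mod_cast (by omega : 1 ≤ k)
  have hlog1 : 1 ≤ Real.log k := by
    rw [Real.le_log_iff_exp_le hk0]
    have := Real.exp_one_lt_d9
    have : (3 : ℝ) ≤ k := by exact_mod_cast hk3
    linarith
  have hL : Real.log k ^ (2 * m) ≤ (k : ℝ) ^ δ := by
    simp only [Function.comp_apply, Real.rpow_natCast, Real.norm_eq_abs, one_mul] at hk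
    rwa [abs_of_nonneg (by positivity), abs_of_nonneg (by positivity)] at hk
  rw [Real.norm_of_nonneg (by positivity), Real.norm_of_nonneg (by positivity)]
  set R := (k : ℝ) ^ (9 / 5 : ℝ) + (k : ℝ) ^ (2 * (m : ℝ) - 1 + 1 / ((m : ℝ) + 1)) with hR
  have hR0 : 0 ≤ R := by positivity
  have b2 : (k : ℝ) ^ (2 * (m : ℝ) - 1) * (k : ℝ) ^ δ ≤ R := by
    rw [← Real.rpow_add hk0]
    refine le_trans (Real.rpow_le_rpow_of_exponent_le hk1 (by linarith))
      (le_add_of_nonneg_left (by positivity))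
  have b1 : (k : ℝ) ^ ((m : ℝ) + 3 / 4) * (k : ℝ) ^ δ ≤ R := by
    rcases hm.eq_or_lt with rfl | hm2
    · rw [← Real.rpow_add hk0]
      refine le_trans (Real.rpow_le_rpow_of_exponent_le hk1 ?_)
        (le_add_of_nonneg_right (by positivity))
      push_cast; linarith
    -- For `m ≥ 2`, `m + 3/4 ≤ 2m - 1`, so the second power dominates.
    · have hm2' : (2 : ℝ) ≤ m := by exact_mod_cast hm2
      refine le_trans ?_ b2
      gcongr
      linarith
  calc _ ≤ ((k : ℝ) ^ ((m : ℝ) + 3 / 4) + (k : ℝ) ^ (2 * (m : ℝ) - 1)) * (k : ℝ) ^ δ := by gcongr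
    _ ≤ 2 * R := by rw [add_mul]; linarith
    _ ≤ _ := by
      have := le_mul_of_one_le_right hR0 (one_le_pow₀ hlog1 (n := 3))
      linarith

theorem theorem2 (m : ℕ) (hm : 1 ≤ m) :
    (∃! f : ArithmeticFunction ℝ, HasMomentFactorSeries m f) ∧
    ∀ f : ArithmeticFunction ℝ, HasMomentFactorSeries m f →
      (fun k : ℕ =>
          (∑ h ∈ (Finset.Icc 1 k).filter (fun h : ℕ => Nat.Coprime h k),
              dedekindSum (h : ℤ) k ^ (2 * m)) -
            f k * ((k : ℝ) / 12) ^ (2 * m))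
        =O[Filter.atTop]
      (fun k : ℕ =>
          ((k : ℝ) ^ (9 / 5 : ℝ) + (k : ℝ) ^ (2 * (m : ℝ) - 1 + 1 / ((m : ℝ) + 1))) *
            Real.log (k : ℝ) ^ 3) := by
  have hf₀ := hasMomentFactorSeries_momentFactor hm
  refine ⟨⟨momentFactor m, hf₀, fun g hg => hg.unique hf₀⟩, fun f hf => ?_⟩
  rw [hf.unique hf₀]
  refine Asymptotics.IsBigO.trans (Asymptotics.IsBigO.of_bound ((60 ^ (2 * m) + 2 ^ (2 * m) +
    22 * m * 4 ^ (2 * m - 1)) * (2 * zetaSum (3 / 2) ^ 2)) ?_) (rpow_mul_log_pow_isBigO hm)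
  filter_upwards [Filter.eventually_ge_atTop 3] with k hk
  refine (abs_sum_dedekindSum_pow_sub_le hm hk).trans ?_
  gcongr
  exact le_abs_self _
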